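/- Let $d\ge 1$. For an odd integer $n\ge 3$ let $\mathbb{T}_n^d=(\mathbb{Z}/n\mathbb{Z})^d$ be the discrete torus with its nearest-neighbour graph structure $\sim$, let $P=(p_{\mathbf i\mathbf j})$ be the transition matrix of simple random walk on it ($p_{\mathbf i\mathbf j}=\frac1{2d}$ if $\mathbf i\sim\mathbf j$ and $0$ otherwise), and attach to the sites independent unit-intensity Poisson clocks. Let $\mathbf Y(t)=(Y_{\mathbf i}(t))_{\mathbf i\in\mathbb{T}_n^d}$, $t\ge0$, be the smoothing process started from unit mass at the origin: $Y_{\mathbf i}(0)=1$ if $\mathbf i=\mathbf 0$ and $Y_{\mathbf i}(0)=0$ otherwise; when the clock at $\mathbf k$ rings at time $t$, the value at $\mathbf k$ is updated to $Y_{\mathbf k}(t)=\sum_{\mathbf j}p_{\mathbf k\mathbf j}Y_{\mathbf j}(t-)$ and all other values remain unchanged. Put $$\mathcal E(t)=\frac1{4dn^d}\sum_{\mathbf i\sim\mathbf j}\bigl(Y_{\mathbf i}(t)-Y_{\mathbf j}(t)\bigr)^2,\qquad \mathcal V(t)=n^{-d}\sum_{\mathbf i}\bigl(Y_{\mathbf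 i}(t)-\overline Y(t)\bigr)^2,\qquad \overline Y(t)=n^{-d}\sum_{\mathbf i}Y_{\mathbf i}(t),$$ where the first sum is over all ordered pairs of neighbours, and let $\gamma^{(1)}_1=1-\cos(2\pi/n)$. Then there exist constants $\alpha_1,\alpha_2,\alpha_3>0$, $n_0\ge3$ and $t_0>0$, all depending only on $d$, such that for all odd $n\ge n_0$ and all real $t\ge t_0$, $$\frac{\alpha_1 n^{-d}}{t^{\frac d2+1}\wedge n^{d+2}}\exp\left(-\frac{2\gamma^{(1)}_1}{d}\,t\right)\le\mathbb E\,\mathcal E(t)\le\frac{\alpha_2 n^{-d}}{t^{\frac d2+1}\wedge n^{d+2}}\exp\left(-\left(\frac{2\gamma^{(1)}_1}{d}-\frac{\alpha_3}{n^{d+4}}\right)t\right)$$ and $$\frac{\alpha_1 n^{-d}}{t^{\frac d2}\wedge n^{d}}\exp\left(-\left(\frac{2\gamma^{(1)}_1}{d}+\frac{\alpha_3}{n^{d+4}}\right)t\right)\le\mathbb E\,\mathcal V(t)\le\frac{\alpha_2 n^{-d}}{t^{\frac d2}\wedge n^{d}}\exp\left(-\left(\frac{2\gamma^{(1)}_1}{d}-\frac{\alpha_3}{n^{d+4}}\right)t\right).$$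 -/

import Mathlib

open MeasureTheory ProbabilityTheory Filter Topology
open scoped NNReal

/-- `N` is a unit-intensity Poisson process on `[0, ∞)`: it starts at `0`, has independent
increments, its increment over `(s, t]` has the Poisson law with mean `t - s`, and almost every path
is non-decreasing and right-continuous (the subtraction in `ℕ` is therefore the usual one). -/
structure IsUnitPoissonProcess {Ω : Type*} [MeasurableSpace Ω]
    (N : ℝ≥0 → Ω → ℕ) (μ : Measure Ω) : Prop where
  measurable : ∀ t, Measurable (N t)
  start : ∀ᵐ ω ∂μ, N 0 ω = 0
  mono : ∀ᵐ ω ∂μ, Monotone fun t => N t ω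
  right_cont : ∀ᵐ ω ∂μ, ∀ t, ContinuousWithinAt (fun s => N s ω) (Set.Ici t) t
  indep_increments : HasIndepIncrements N μ
  poisson_increments : ∀ s t : ℝ≥0, s ≤ t →
    HasLaw (fun ω => N t ω - N s ω) (poissonMeasure (t - s)) μ

/-- `N i`, for `i : ι`, are jointly independent unit-intensity Poisson processes (the clocks). -/
structure IsPoissonClocks {ι Ω : Type*} [MeasurableSpace Ω]
    (N : ι → ℝ≥0 → Ω → ℕ) (μ : Measure Ω) : Prop where
  poisson : ∀ i, IsUnitPoissonProcess (N i) μ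
  indep : iIndepFun (fun i ω => fun t : ℝ≥0 => N i t ω) μ

/-- The clock with counting path `c` rings at time `t`: the path jumps at `t > 0`. -/
def RingsAt (c : ℝ≥0 → ℕ) (t : ℝ≥0) : Prop :=
  0 < t ∧ ∀ s < t, c s < c t

/-- `Y` is the smoothing process with transition matrix `P`, started from the (deterministic) mass
distribution `y₀`, driven by the independent unit Poisson clocks `N`. Almost surely: the mass at `k`
does not change over a time interval in which the clock at `k` does not ring, and when the clock at
`k` rings at time `t` the mass at `k` becomes `∑ j, P k j * Y_j(t-)`. -/
structure IsSmoothingProcess {ι Ω : Type*} [Fintype ι] [MeasurableSpace Ω]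
    (P : Matrix ι ι ℝ) (y₀ : ι → ℝ) (N : ι → ℝ≥0 → Ω → ℕ) (Y : ℝ≥0 → Ω → ι → ℝ)
    (μ : Measure Ω) : Prop where
  clocks : IsPoissonClocks N μ
  start : ∀ᵐ ω ∂μ, Y 0 ω = y₀
  no_ring : ∀ᵐ ω ∂μ, ∀ k, ∀ s t : ℝ≥0, s ≤ t → N k s ω = N k t ω → Y t ω k = Y s ω k
  ring : ∀ᵐ ω ∂μ, ∀ k, ∀ t : ℝ≥0, RingsAt (fun s => N k s ω) t →
    Y t ω k = ∑ j, P k j * Function.leftLim (fun s => Y s ω j) t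

/-- The discrete torus `(ℤ/nℤ)^d`. -/
abbrev Torus (d n : ℕ) : Type := Fin d → ZMod n

/-- Nearest-neighbour graph on the torus: distinct `x`, `y` are adjacent iff `x - y = e_k` or
`y - x = e_k` for some coordinate `k`. -/
def torusGraph (d n : ℕ) : SimpleGraph (Torus d n) :=
  SimpleGraph.circulantGraph (Set.range fun k : Fin d => (Pi.single k 1 : Torus d n))

open scoped Classical in
/-- Transition matrix of simple random walk on a finite graph. -/
noncomputable def srwMatrix {V : Type*} [Fintype V] (G : SimpleGraph V) : Matrix V V ℝ :=
  fun x y => if G.Adj x y then ((G.degree x : ℝ))⁻¹ else 0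

/-- The variance of `y` under the weights `π`. -/
noncomputable def varianceFunctional {ι : Type*} [Fintype ι] (π : ι → ℝ) (y : ι → ℝ) : ℝ :=
  ∑ i, π i * (y i - ∑ j, π j * y j) ^ 2

/-- The variance functional on the torus: the weights are the stationary distribution of simple
random walk, that is, the uniform distribution. -/
noncomputable def torusVariance (d n : ℕ) [NeZero n] (y : Torus d n → ℝ) : ℝ :=
  varianceFunctional (fun _ => ((n : ℝ) ^ d)⁻¹) y

open scoped Classical in
/-- The energy functional on the torus, `(4 d n^d)⁻¹ ∑ (y_i - y_j)²` over all ordered pairs of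
neighbours. -/
noncomputable def torusEnergy (d n : ℕ) [NeZero n] (y : Torus d n → ℝ) : ℝ :=
  1 / (4 * d * (n : ℝ) ^ d) *
    ∑ i, ∑ j, if (torusGraph d n).Adj i j then (y i - y j) ^ 2 else 0

/-- The spectral gap `1 - cos (2π/n)` of simple random walk on the cycle `ℤ/nℤ`. -/
noncomputable def cycleGap (n : ℕ) : ℝ := 1 - Real.cos (2 * Real.pi / n)

/-!
Write `ŷ_k` for the Fourier coefficients of `y` on the torus and `λ_k` for the eigenvalues of
`1 - P`. The change of `|ŷ_k|²` when the clock at `i` rings is a linear term, which sums over `i` to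
`-2 λ_k |ŷ_k|²`, plus the square of `((1 - P) y)_i`, which does not depend on `k`. Therefore the
expected power spectrum `G_k(t) = 𝔼 |Ŷ_k(t)|²` solves the closed linear system
`G_k' = -2 λ_k G_k + φ`, `φ = n^(-d) ∑ k, λ_k² G_k`, `G_k(0) = 1`, and
`n^d 𝔼 𝓔 = n^(-d) ∑ k, λ_k G_k`, `n^d 𝔼 𝓥 = n^(-d) ∑ k ≠ 0, G_k`.

The system is derived without a theory of Markov jump processes. On a dyadic grid the process is
compared with a chain driven by the increments of the clocks, which ignores steps with two or more
rings. For the chain the recursion in expectation is exact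
(`integral_comp_randomChain`), almost surely the chain on a fine enough grid agrees with the process
at time `t` (`IsSmoothingProcess.ae_eventually_eq_randomChain`), and the powers of the one-step
operators converge to an exponential (`IsSmoothingProcess.integral_comp_eq_exp`).

The lower bounds follow from `φ ≥ 0`, that is from `G_k(t) ≥ exp (-2 λ_k t)`, and from counting
modes with `λ_k` of order `1 / t`, or from one lowest mode after the mixing time of order `n²`.

For the upper bounds, Duhamel's formula turns the system into a renewal equation
`φ = a + φ ∗ a` whose kernel `a(t) = n^(-d) ∑ k, λ_k² exp (-2 λ_k t)` has mass `1 / 2`. The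
kernel decays like `t^(-d/2-2)` up to time `n²` and like `n^(-d-4) exp (-2 γ t / d)` afterwards
(`renewalKernel_torus_le`), where `γ` is the spectral gap of the cycle. With the exponential rate
lowered to `r = 2 γ / d - 6400 / n^(d+4)`, the kernel multiplied by `exp (r t)` still has mass at
most `3 / 4` (`sum_lyapunov_weight_le`): this is where the correction of order `n^(-d-4)`
comes from. A defective renewal equation passes the decay of its kernel on to its solution
(`PowerEvolution.source_le`). As `n^(-d) ∑ k, λ_k = 1`, the energy has derivative `-φ`, and a
combination of the variance and the energy has derivative `-2` times the energy, so that two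
integrations give the bounds for the energy and for the variance
(`PowerEvolution.energy_le`, `PowerEvolution.variance_le`).
-/

/-! ### Paths of the smoothing process between grid points -/

/-- The mass distribution after the clock at `k` has rung: the value at `k` is replaced by its
`P`-average. -/
def ringUpdate {ι : Type*} [Fintype ι] [DecidableEq ι] (P : Matrix ι ι ℝ) (k : ι) (y : ι → ℝ) :
    ι → ℝ :=
  Function.update y k (∑ j, P k j * y j)

section Path

variable {ι : Type*} [Fintype ι] [DecidableEq ι]

/-- If over `(s, t]` the clock at `k` rings exactly once and no other clock rings, the mass
distribution is updated exactly once, at `k`. -/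
lemma eq_ringUpdate_of_single_ring {P : Matrix ι ι ℝ} {c : ι → ℝ≥0 → ℕ} {y : ℝ≥0 → ι → ℝ}
    (hmono : ∀ i, Monotone (c i))
    (hrc : ∀ i t, ContinuousWithinAt (c i) (Set.Ici t) t)
    (hno : ∀ k, ∀ s t : ℝ≥0, s ≤ t → c k s = c k t → y t k = y s k)
    (hring : ∀ k, ∀ t : ℝ≥0, RingsAt (c k) t →
      y t k = ∑ j, P k j * Function.leftLim (fun s => y s j) t)
    {s t : ℝ≥0} (hst : s ≤ t) {k : ι} (hk : c k t = c k s + 1)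
    (hj : ∀ j, j ≠ k → c j t = c j s) :
    y t = ringUpdate P k (y s) := by
  -- `τ` is the ring time of the clock at `k`
  set S : Set ℝ≥0 := {u | s ≤ u ∧ c k u = c k t} with hS
  have htS : t ∈ S := ⟨hst, rfl⟩
  set τ := sInf S with hτ
  have hbdd : BddBelow S := ⟨s, fun u hu => hu.1⟩
  have hτt : τ ≤ t := csInf_le hbdd htS
  have hsτ : s ≤ τ := le_csInf ⟨t, htS⟩ fun u hu => hu.1
  have hcτ : c k τ = c k t := by
    have hev : ∀ᶠ u in 𝓝[Set.Ici τ] τ, c k u = c k τ := by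
      filter_upwards [(hrc k τ).eventually (IsOpen.mem_nhds (isOpen_discrete {c k τ}) rfl)]
        with u hu
      exact hu
    rw [eventually_nhdsWithin_iff, Metric.eventually_nhds_iff] at hev
    obtain ⟨ε, hε, hball⟩ := hev
    obtain ⟨u, huS, hu⟩ := exists_lt_of_csInf_lt ⟨t, htS⟩
      (show sInf S < τ + ⟨ε, hε.le⟩ from lt_add_of_pos_right _ hε)
    have hτu : τ ≤ u := csInf_le hbdd huS
    have := hball (y := u) (by
      rw [NNReal.dist_eq, abs_of_nonneg (sub_nonneg.2 (NNReal.coe_le_coe.2 hτu))]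
      have : (u : ℝ) < τ + ε := by exact_mod_cast hu
      linarith) hτu
    rw [← this, huS.2]
  have hsτ' : s < τ := lt_of_le_of_ne hsτ (by rintro h; rw [← h] at hcτ; omega)
  have hbefore : ∀ u, s ≤ u → u < τ → c k u = c k s := by
    intro u hsu huτ
    have h1 : c k u ≠ c k t := fun h => absurd (csInf_le hbdd ⟨hsu, h⟩) (not_le.2 huτ)
    have h2 := hmono k hsu
    have h3 := hmono k (huτ.le.trans hτt)
    omega
  have hR : RingsAt (c k) τ := by
    refine ⟨lt_of_le_of_lt (zero_le) hsτ', fun u hu => ?_⟩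
    rcases le_total s u with h | h
    · rw [hbefore u h hu]; omega
    · have := hmono k h; omega
  have hll : ∀ j, Function.leftLim (fun u => y u j) τ = y s j := by
    intro j
    have : (𝓝[<] τ).NeBot := nhdsLT_neBot_of_exists_lt ⟨s, hsτ'⟩
    refine leftLim_eq_of_tendsto (tendsto_const_nhds.congr' ?_)
    filter_upwards [Ioo_mem_nhdsLT hsτ'] with u hu
    refine (hno j s u hu.1.le ?_).symm
    by_cases h : j = k
    · subst h; exact (hbefore u hu.1.le hu.2).symm
    · have h1 := hmono j hu.1.le
      have h2 := hmono j (hu.2.le.trans hτt)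
      have h3 := hj j h
      omega
  funext j
  by_cases h : j = k
  · subst h
    rw [hno j τ t hτt hcτ, hring j τ hR]
    simp [ringUpdate, hll]
  · simp [ringUpdate, h, hno j s t hst (hj j h).symm]

open scoped Classical in
/-- One step of the discretised smoothing process, given the vector `v` of numbers of rings in the
step: update at `k` if only the clock at `k` rang, and only once; otherwise change nothing. -/
noncomputable def stepUpdate (P : Matrix ι ι ℝ) (v : ι → ℕ) (y : ι → ℝ) : ι → ℝ :=
  if h : ∃ k, v = Pi.single k 1 then ringUpdate P h.choose y else y

/-- The discretised smoothing process driven by the numbers of rings `v l`, `l = 0, 1, …`, in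
consecutive steps. -/
noncomputable def stepChain (P : Matrix ι ι ℝ) (y₀ : ι → ℝ) (v : ℕ → ι → ℕ) : ℕ → ι → ℝ
  | 0 => y₀
  | l + 1 => stepUpdate P (v l) (stepChain P y₀ v l)

lemma single_one_injective {ι : Type*} [DecidableEq ι] :
    Function.Injective fun k : ι => (Pi.single k 1 : ι → ℕ) := by
  intro k l h
  by_contra hkl
  have := congrFun h k
  simp [hkl] at this

lemma stepUpdate_single (P : Matrix ι ι ℝ) (k : ι) (y : ι → ℝ) :
    stepUpdate P (Pi.single k 1) y = ringUpdate P k y := by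
  have h : ∃ l, (Pi.single k 1 : ι → ℕ) = Pi.single l 1 := ⟨k, rfl⟩
  rw [stepUpdate, dif_pos h, ← single_one_injective h.choose_spec]

lemma stepUpdate_of_ne {P : Matrix ι ι ℝ} {v : ι → ℕ} (hv : ∀ k, v ≠ Pi.single k 1) (y : ι → ℝ) :
    stepUpdate P v y = y := by
  rw [stepUpdate, dif_neg (by simpa using hv)]

lemma apply_stepUpdate {E : Type*} [AddCommGroup E] (f : (ι → ℝ) → E) (P : Matrix ι ι ℝ)
    (v : ι → ℕ) (y : ι → ℝ) :
    f (stepUpdate P v y) =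
      f y + ∑ k, if v = Pi.single k 1 then f (ringUpdate P k y) - f y else 0 := by
  by_cases h : ∃ k, v = Pi.single k 1
  · obtain ⟨k, rfl⟩ := h
    have : ∀ l, ((Pi.single k 1 : ι → ℕ) = Pi.single l 1) ↔ l = k :=
      fun l => ⟨fun h => (single_one_injective h).symm, fun h => by rw [h]⟩
    simp [stepUpdate_single, this]
  · push Not at h
    simp [stepUpdate_of_ne h, h]

lemma abs_ringUpdate_le {P : Matrix ι ι ℝ} (hP : ∀ i, ∑ j, |P i j| ≤ 1) {y : ι → ℝ} {C : ℝ}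
    (hy : ∀ i, |y i| ≤ C) (k i : ι) : |ringUpdate P k y i| ≤ C := by
  have hC : 0 ≤ C := (abs_nonneg _).trans (hy i)
  by_cases h : i = k
  · subst h
    simp only [ringUpdate, Function.update_self]
    calc |∑ j, P i j * y j| ≤ ∑ j, |P i j| * C := by
          refine (Finset.abs_sum_le_sum_abs _ _).trans (Finset.sum_le_sum fun j _ => ?_)
          rw [abs_mul]
          exact mul_le_mul_of_nonneg_left (hy j) (abs_nonneg _)
      _ ≤ C := by
          rw [← Finset.sum_mul]
          exact mul_le_of_le_one_left hC (hP i)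
  · simp [ringUpdate, h, hy]

lemma abs_stepChain_le {P : Matrix ι ι ℝ} (hP : ∀ i, ∑ j, |P i j| ≤ 1) {y₀ : ι → ℝ} {C : ℝ}
    (hy : ∀ i, |y₀ i| ≤ C) (v : ℕ → ι → ℕ) (l : ℕ) (i : ι) : |stepChain P y₀ v l i| ≤ C := by
  induction l generalizing i with
  | zero => exact hy i
  | succ l ih =>
    by_cases h : ∃ k, v l = Pi.single k 1
    · obtain ⟨k, hk⟩ := h
      simpa [stepChain, hk, stepUpdate_single] using abs_ringUpdate_le hP ih k i
    · push Not at h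
      simpa [stepChain, stepUpdate_of_ne h] using ih i

lemma stepChain_congr (P : Matrix ι ι ℝ) (y₀ : ι → ℝ) {v w : ℕ → ι → ℕ} {l : ℕ}
    (h : ∀ m < l, v m = w m) : stepChain P y₀ v l = stepChain P y₀ w l := by
  induction l with
  | zero => rfl
  | succ l ih =>
    rw [stepChain, stepChain, h l (Nat.lt_succ_self l),
      ih fun m hm => h m (hm.trans l.lt_succ_self)]

/-- On a time grid with at most one ring in each step, the smoothing process is given on the grid by
the chain of updates. -/
lemma eq_stepChain_of_grid {P : Matrix ι ι ℝ} {c : ι → ℝ≥0 → ℕ} {y : ℝ≥0 → ι → ℝ} {y₀ : ι → ℝ}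
    (hstart : y 0 = y₀) (hmono : ∀ i, Monotone (c i))
    (hrc : ∀ i t, ContinuousWithinAt (c i) (Set.Ici t) t)
    (hno : ∀ k, ∀ s t : ℝ≥0, s ≤ t → c k s = c k t → y t k = y s k)
    (hring : ∀ k, ∀ t : ℝ≥0, RingsAt (c k) t →
      y t k = ∑ j, P k j * Function.leftLim (fun s => y s j) t)
    {τ : ℕ → ℝ≥0} (hτ0 : τ 0 = 0) (hτ : Monotone τ) {m : ℕ}
    (hgood : ∀ l < m, (fun i => c i (τ (l + 1)) - c i (τ l)) = 0 ∨
      ∃ k, (fun i => c i (τ (l + 1)) - c i (τ l)) = Pi.single k 1) :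
    y (τ m) = stepChain P y₀ (fun l i => c i (τ (l + 1)) - c i (τ l)) m := by
  induction m with
  | zero => simp [stepChain, hτ0, hstart]
  | succ m ih =>
    have ih := ih fun l hl => hgood l (hl.trans m.lt_succ_self)
    have hm : ∀ i, c i (τ m) ≤ c i (τ (m + 1)) := fun i => hmono i (hτ m.le_succ)
    rcases hgood m m.lt_succ_self with h | ⟨k, h⟩
    · rw [stepChain, stepUpdate_of_ne, ← ih]
      · funext i
        refine hno i _ _ (hτ m.le_succ) ?_
        have := congrFun h i
        have := hm i
        simp only [Pi.zero_apply] at *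
        omega
      · intro k hk
        have := congrFun (h.symm.trans hk) k
        simp at this
    · rw [stepChain, h, stepUpdate_single, ← ih]
      refine eq_ringUpdate_of_single_ring (t := τ (m + 1)) hmono hrc hno hring (hτ m.le_succ) ?_
        fun j hj => ?_
      · have := congrFun h k
        have := hm k
        simp only [Pi.single_eq_same] at *
        omega
      · have h1 := congrFun h j
        have := hm j
        rw [Pi.single_eq_of_ne hj] at h1
        omega

end Path

/-! ### The discretised process and its expectations -/

section Chain

lemma exists_norm_le_of_abs_le {ι E : Type*} [NormedAddCommGroup E] {f : (ι → ℝ) → E}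
    (hf : Continuous f) (C : ℝ) :
    ∃ B, ∀ y : ι → ℝ, (∀ i, |y i| ≤ C) → ‖f y‖ ≤ B := by
  have hK : IsCompact (Set.univ.pi fun _ : ι => Set.Icc (-C) C) :=
    isCompact_univ_pi fun _ => isCompact_Icc
  obtain ⟨B, hB⟩ := hK.exists_bound_of_continuousOn hf.continuousOn
  exact ⟨B, fun y hy => hB y fun i _ => abs_le.1 (hy i)⟩

variable {ι Ω : Type*} [MeasurableSpace Ω] {μ : Measure Ω}

/-- The vector of numbers of rings of all clocks in the step `(l δ, (l + 1) δ]`. -/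
def ringCounts (N : ι → ℝ≥0 → Ω → ℕ) (δ : ℝ≥0) (l : ℕ) (ω : Ω) (i : ι) : ℕ :=
  N i ((l + 1 : ℕ) * δ) ω - N i (l * δ) ω

lemma monotone_natCast_mul (δ : ℝ≥0) : Monotone fun l : ℕ => (l : ℝ≥0) * δ :=
  fun _ _ h => mul_le_mul_of_nonneg_right (Nat.cast_le.2 h) δ.2

lemma measurable_ringCounts_apply {N : ι → ℝ≥0 → Ω → ℕ} (h : IsPoissonClocks N μ) (δ : ℝ≥0)
    (l : ℕ) (i : ι) : Measurable fun ω => ringCounts N δ l ω i :=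
  ((h.poisson i).measurable _).sub ((h.poisson i).measurable _)

lemma measurable_ringCounts {N : ι → ℝ≥0 → Ω → ℕ} (h : IsPoissonClocks N μ) (δ : ℝ≥0) (l : ℕ) :
    Measurable (ringCounts N δ l) :=
  measurable_pi_lambda _ fun i => measurable_ringCounts_apply h δ l i

lemma iIndepFun_ringCounts {N : ι → ℝ≥0 → Ω → ℕ} (h : IsPoissonClocks N μ) (δ : ℝ≥0) :
    iIndepFun (fun (p : ι × ℕ) ω => ringCounts N δ p.2 ω p.1) μ := by
  refine iIndepFun_uncurry' (X := fun i l ω => ringCounts N δ l ω i)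
    (fun i l => measurable_ringCounts_apply h δ l i) ?_ fun i => ?_
  · exact h.indep.comp (fun _ c (l : ℕ) => c ((l + 1 : ℕ) * δ) - c (l * δ)) fun i =>
      measurable_pi_lambda _ fun l => (measurable_pi_apply _).sub (measurable_pi_apply _)
  · exact (h.poisson i).indep_increments.nat (monotone_natCast_mul δ)

variable [Fintype ι]

lemma measureReal_ringCounts_eq {N : ι → ℝ≥0 → Ω → ℕ} (h : IsPoissonClocks N μ) (δ : ℝ≥0)
    (l : ℕ) (v : ι → ℕ) :
    μ.real {ω | ringCounts N δ l ω = v} =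
      ∏ i, (Real.exp (-δ) * (δ : ℝ) ^ v i / (v i).factorial) := by
  have hind : iIndepFun (fun i ω => ringCounts N δ l ω i) μ :=
    (iIndepFun_ringCounts h δ).precomp (g := fun i : ι => (i, l)) fun i j hij => by simpa using hij
  have hset : {ω | ringCounts N δ l ω = v} = ⋂ i, (fun ω => ringCounts N δ l ω i) ⁻¹' {v i} := by
    ext ω; simp [funext_iff]
  rw [hset, measureReal_def, hind.meas_iInter fun i => ⟨{v i}, measurableSet_singleton _, rfl⟩,
    ENNReal.toReal_prod]
  refine Finset.prod_congr rfl fun i _ => ?_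
  have hlaw := (h.poisson i).poisson_increments _ _ (monotone_natCast_mul δ l.le_succ)
  have hδ : ((l + 1 : ℕ) : ℝ≥0) * δ - l * δ = δ := by
    rw [Nat.cast_succ, add_mul, one_mul, add_tsub_cancel_left]
  simp only [Nat.succ_eq_add_one, hδ] at hlaw
  have := hlaw.measureReal_eq (p := fun x => x = v i) (measurableSet_singleton _)
  simp only [Set.ofPred_eq_eq_singleton, poissonMeasure_real_singleton] at this
  rw [← this]
  rfl

lemma measureReal_ringCounts_eq_zero {N : ι → ℝ≥0 → Ω → ℕ} (h : IsPoissonClocks N μ) (δ : ℝ≥0)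
    (l : ℕ) :
    μ.real {ω | ringCounts N δ l ω = 0} = Real.exp (-(Fintype.card ι * δ)) := by
  rw [measureReal_ringCounts_eq h]
  simp [← Real.exp_nat_mul]

variable [DecidableEq ι]

lemma measureReal_ringCounts_eq_single {N : ι → ℝ≥0 → Ω → ℕ} (h : IsPoissonClocks N μ) (δ : ℝ≥0)
    (l : ℕ) (k : ι) :
    μ.real {ω | ringCounts N δ l ω = Pi.single k 1} =
      δ * Real.exp (-(Fintype.card ι * δ)) := by
  rw [measureReal_ringCounts_eq h]
  have : ∀ i, Real.exp (-δ) * (δ : ℝ) ^ (Pi.single k 1 : ι → ℕ) i /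
      ((Pi.single k 1 : ι → ℕ) i).factorial = Real.exp (-δ) * if i = k then (δ : ℝ) else 1 := by
    intro i
    by_cases hi : i = k
    · subst hi; simp
    · simp [hi]
  simp only [this, Finset.prod_mul_distrib, Finset.prod_ite_eq', Finset.mem_univ, if_true]
  simp [← Real.exp_nat_mul, mul_comm]

/-- The probability of two or more rings in one step is of second order in the step. -/
lemma measureReal_two_rings_le [IsProbabilityMeasure μ] {N : ι → ℝ≥0 → Ω → ℕ}
    (h : IsPoissonClocks N μ) (δ : ℝ≥0) (l : ℕ) :
    μ.real {ω | ¬(ringCounts N δ l ω = 0 ∨ ∃ k, ringCounts N δ l ω = Pi.single k 1)} ≤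
      (Fintype.card ι * δ) ^ 2 := by
  set x : ℝ := Fintype.card ι * δ with hx
  have hms : ∀ v, MeasurableSet {ω | ringCounts N δ l ω = v} := fun v =>
    measurable_ringCounts h δ l (measurableSet_singleton v)
  have hU : {ω | ringCounts N δ l ω = 0 ∨ ∃ k, ringCounts N δ l ω = Pi.single k 1} =
      {ω | ringCounts N δ l ω = 0} ∪ ⋃ k, {ω | ringCounts N δ l ω = Pi.single k 1} := by
    ext ω; simp
  have hmU : MeasurableSet
      {ω | ringCounts N δ l ω = 0 ∨ ∃ k, ringCounts N δ l ω = Pi.single k 1} := by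
    rw [hU]; exact (hms 0).union (MeasurableSet.iUnion fun k => hms _)
  have hreal : μ.real {ω | ringCounts N δ l ω = 0 ∨ ∃ k, ringCounts N δ l ω = Pi.single k 1} =
      Real.exp (-x) * (1 + x) := by
    rw [hU, measureReal_union _ (MeasurableSet.iUnion fun k => hms _),
      measureReal_iUnion_fintype _ fun k => hms _]
    · simp only [measureReal_ringCounts_eq_single h, measureReal_ringCounts_eq_zero h]
      simp only [Finset.sum_const, Finset.card_univ, nsmul_eq_mul, ← hx]
      rw [← mul_assoc, ← hx]; ring
    · intro k k' hkk'
      rw [Function.onFun, Set.disjoint_left]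
      intro ω h1 h2
      exact hkk' (single_one_injective (h1.symm.trans h2))
    · rw [Set.disjoint_left]
      intro ω h1 h2
      obtain ⟨k, hk⟩ := Set.mem_iUnion.1 h2
      have := congrFun ((show ringCounts N δ l ω = 0 from h1).symm.trans hk) k
      simp at this
  have hc : {ω | ¬(ringCounts N δ l ω = 0 ∨ ∃ k, ringCounts N δ l ω = Pi.single k 1)} =
    {ω | ringCounts N δ l ω = 0 ∨ ∃ k, ringCounts N δ l ω = Pi.single k 1}ᶜ := rfl
  rw [hc, probReal_compl_eq_one_sub hmU, hreal]
  have h1 := Real.one_sub_le_exp_neg x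
  have h0 : 0 ≤ x := by positivity
  nlinarith

/-- The chain after `l` steps, as a random variable. -/
noncomputable def randomChain (P : Matrix ι ι ℝ) (y₀ : ι → ℝ) (N : ι → ℝ≥0 → Ω → ℕ) (δ : ℝ≥0)
    (l : ℕ) (ω : Ω) : ι → ℝ :=
  stepChain P y₀ (fun m => ringCounts N δ m ω) l

lemma randomChain_eq_comp {Ω : Type*} (P : Matrix ι ι ℝ) (y₀ : ι → ℝ) (N : ι → ℝ≥0 → Ω → ℕ)
    (δ : ℝ≥0) (l : ℕ) :
    randomChain P y₀ N δ l =
      (fun x : (Finset.univ ×ˢ Finset.range l : Finset (ι × ℕ)) → ℕ =>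
        stepChain P y₀ (fun m i => if h : (i, m) ∈ (Finset.univ ×ˢ Finset.range l : Finset (ι × ℕ))
          then x ⟨(i, m), h⟩ else 0) l) ∘ fun ω p => ringCounts N δ p.1.2 ω p.1.1 := by
  funext ω
  refine stepChain_congr P y₀ fun m hm => ?_
  funext i
  simp [hm]

lemma measurable_randomChain (P : Matrix ι ι ℝ) (y₀ : ι → ℝ) {N : ι → ℝ≥0 → Ω → ℕ}
    (h : IsPoissonClocks N μ) (δ : ℝ≥0) (l : ℕ) : Measurable (randomChain P y₀ N δ l) := by
  rw [randomChain_eq_comp]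
  exact Measurable.of_discrete.comp
    (measurable_pi_lambda _ fun p => measurable_ringCounts_apply h δ _ _)

lemma indepFun_randomChain_ringCounts (P : Matrix ι ι ℝ) (y₀ : ι → ℝ) {N : ι → ℝ≥0 → Ω → ℕ}
    (h : IsPoissonClocks N μ) (δ : ℝ≥0) (l : ℕ) :
    IndepFun (ringCounts N δ l) (randomChain P y₀ N δ l) μ := by
  have hind := (iIndepFun_ringCounts h δ).indepFun_finset (Finset.univ ×ˢ {l})
    (Finset.univ ×ˢ Finset.range l) (by
      rw [Finset.disjoint_left]; rintro ⟨i, m⟩; simp +contextual)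
    fun p => measurable_ringCounts_apply h δ _ _
  have hV : ringCounts N δ l =
      (fun (x : (Finset.univ ×ˢ {l} : Finset (ι × ℕ)) → ℕ) i => x ⟨(i, l), by simp⟩) ∘
        fun ω p => ringCounts N δ p.1.2 ω p.1.1 := by
    funext ω i; simp
  rw [randomChain_eq_comp P y₀ N δ l]
  nth_rewrite 1 [hV]
  exact hind.comp Measurable.of_discrete Measurable.of_discrete

lemma integrable_comp_randomChain {E : Type*} [NormedAddCommGroup E] [IsProbabilityMeasure μ]
    {P : Matrix ι ι ℝ} (hP : ∀ i, ∑ j, |P i j| ≤ 1) (y₀ : ι → ℝ) {N : ι → ℝ≥0 → Ω → ℕ} (h : IsPoissonClocks N μ)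
    {f : (ι → ℝ) → E} (hf : Continuous f) (δ : ℝ≥0) (l : ℕ) :
    Integrable (fun ω => f (randomChain P y₀ N δ l ω)) μ := by
  obtain ⟨B, hB⟩ := exists_norm_le_of_abs_le hf ‖y₀‖
  refine Integrable.of_bound (hf.comp_stronglyMeasurable
    (measurable_randomChain P y₀ h δ l).stronglyMeasurable).aestronglyMeasurable B
    (ae_of_all _ fun ω => hB _ fun i => abs_stepChain_le hP (fun j => norm_le_pi_norm y₀ j) _ _ _)

lemma continuous_ringUpdate (P : Matrix ι ι ℝ) (k : ι) : Continuous (ringUpdate P k) := by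
  refine continuous_id.update k ?_
  fun_prop

/-- If the increments of `f` under the updates sum to a linear function of `f`, the expectation of
`f` along the chain obeys a linear recursion. -/
lemma integral_comp_randomChain {E : Type*} [NormedAddCommGroup E] [NormedSpace ℝ E]
    [IsProbabilityMeasure μ] [CompleteSpace E] {P : Matrix ι ι ℝ}
    (hP : ∀ i, ∑ j, |P i j| ≤ 1) (y₀ : ι → ℝ) {N : ι → ℝ≥0 → Ω → ℕ} (h : IsPoissonClocks N μ)
    {f : (ι → ℝ) → E} (hf : Continuous f) {A : E →L[ℝ] E}
    (hA : ∀ y, ∑ k, (f (ringUpdate P k y) - f y) = A (f y)) (δ : ℝ≥0) (l : ℕ) :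
    ∫ ω, f (randomChain P y₀ N δ l ω) ∂μ =
      ((1 + ((δ : ℝ) * Real.exp (-(Fintype.card ι * δ))) • A) ^ l) (f y₀) := by
  induction l with
  | zero => simp [randomChain, stepChain]
  | succ l ih =>
    classical
    set p := (δ : ℝ) * Real.exp (-(Fintype.card ι * δ)) with hp
    set Z := randomChain P y₀ N δ l with hZ
    set V := ringCounts N δ l with hV
    have hF : ∀ k, Continuous fun y => f (ringUpdate P k y) - f y := fun k =>
      (hf.comp (continuous_ringUpdate P k)).sub hf
    have hiF : ∀ k, Integrable (fun ω => f (ringUpdate P k (Z ω)) - f (Z ω)) μ := fun k =>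
      integrable_comp_randomChain hP y₀ h (hF k) δ l
    have hmV : ∀ v, MeasurableSet {ω | V ω = v} := fun v =>
      measurable_ringCounts h δ l (measurableSet_singleton v)
    have hterm : ∀ k, ∫ ω, (if V ω = Pi.single k 1 then f (ringUpdate P k (Z ω)) - f (Z ω) else 0)
        ∂μ = p • ∫ ω, (f (ringUpdate P k (Z ω)) - f (Z ω)) ∂μ := by
      intro k
      have hind := (indepFun_randomChain_ringCounts P y₀ h δ l).integral_fun_comp_smul_comp
        (f := fun v : ι → ℕ => if v = Pi.single k 1 then (1 : ℝ) else 0)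
        (g := fun y => f (ringUpdate P k y) - f y)
        (measurable_ringCounts h δ l).aemeasurable
        (measurable_randomChain P y₀ h δ l).aemeasurable
        Measurable.of_discrete.aestronglyMeasurable
        (hF k).aestronglyMeasurable
      simp only [ite_smul, one_smul, zero_smul] at hind
      rw [← hV, ← hZ] at hind
      rw [hind]
      congr 1
      rw [hp, ← measureReal_ringCounts_eq_single h δ l k, ← integral_indicator_one (hmV _)]
      exact integral_congr_ae (ae_of_all _ fun ω => by simp [Set.indicator])
    have hstep : ∀ ω, f (randomChain P y₀ N δ (l + 1) ω) = f (Z ω) +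
        ∑ k, if V ω = Pi.single k 1 then f (ringUpdate P k (Z ω)) - f (Z ω) else 0 := by
      intro ω
      rw [← apply_stepUpdate]; rfl
    have hiIf : ∀ k, Integrable (fun ω => if V ω = Pi.single k 1 then
        f (ringUpdate P k (Z ω)) - f (Z ω) else 0) μ := fun k =>
      ((hiF k).indicator (hmV (Pi.single k 1))).congr (ae_of_all _ fun ω => by
        simp [Set.indicator])
    have hiZ : Integrable (fun ω => f (Z ω)) μ := integrable_comp_randomChain hP y₀ h hf δ l
    simp only [hstep]
    rw [integral_add hiZ (integrable_finsetSum _ fun k _ => hiIf k),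
      integral_finsetSum _ fun k _ => hiIf k]
    simp only [hterm]
    rw [← Finset.smul_sum, ← integral_finsetSum _ fun k _ => hiF k]
    simp only [hA]
    rw [A.integral_comp_comm hiZ, ih, pow_succ']
    simp

end Chain

/-! ### The limit of fine grids -/

/-- Euler's limit `(1 + p A)^m → exp (t A)` as `m → ∞` and `m p → t`, in a Banach algebra. -/
lemma tendsto_one_add_smul_pow_exp {𝔸 : Type*} [NormedRing 𝔸] [NormedAlgebra ℝ 𝔸]
    [CompleteSpace 𝔸] (h1 : ‖(1 : 𝔸)‖ ≤ 1) (A : 𝔸) {t : ℝ} {m : ℕ → ℕ}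
    (hm : Tendsto m atTop atTop) {p : ℕ → ℝ} (hp0 : ∀ r, 0 ≤ p r) (hp : ∀ r, m r * p r ≤ t)
    (hmp : Tendsto (fun r => m r * p r) atTop (𝓝 t)) :
    Tendsto (fun r => (1 + p r • A) ^ m r) atTop (𝓝 (NormedSpace.exp (t • A))) := by
  -- bounds on the powers of both sides
  obtain ⟨D, hD⟩ : ∃ D, ∀ s ∈ Set.Icc (0 : ℝ) 1, ‖NormedSpace.exp (s • t • A)‖ ≤ D := by
    refine (isCompact_Icc).exists_bound_of_continuousOn (Continuous.continuousOn ?_)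
    exact continuous_iff_continuousAt.2 fun s => (hasDerivAt_exp_smul_const (t • A) s).continuousAt
  have hD0 : 0 ≤ D := (norm_nonneg _).trans (hD 0 (by simp))
  have hC : ∀ r, ∀ j ≤ m r, ‖(1 + p r • A) ^ j‖ ≤ Real.exp (t * ‖A‖) := by
    intro r j hj
    have hx : ‖1 + p r • A‖ ≤ Real.exp (p r * ‖A‖) := by
      calc ‖1 + p r • A‖ ≤ 1 + p r * ‖A‖ := by
            refine (norm_add_le _ _).trans (add_le_add h1 ?_)
            rw [norm_smul, Real.norm_of_nonneg (hp0 r)]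
        _ ≤ _ := by rw [add_comm]; exact Real.add_one_le_exp _
    have hpow : ‖(1 + p r • A) ^ j‖ ≤ ‖1 + p r • A‖ ^ j := by
      rcases Nat.eq_zero_or_pos j with rfl | hj0
      · simpa using h1
      · exact norm_pow_le' _ hj0
    refine hpow.trans ((pow_le_pow_left₀ (norm_nonneg _) hx j).trans ?_)
    rw [← Real.exp_nat_mul, Real.exp_le_exp, ← mul_assoc]
    refine mul_le_mul_of_nonneg_right ?_ (norm_nonneg _)
    exact (mul_le_mul_of_nonneg_right (Nat.cast_le.2 hj) (hp0 r)).trans (hp r)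
  set y : ℕ → 𝔸 := fun r => NormedSpace.exp ((m r : ℝ)⁻¹ • t • A) with hy
  have hcomm : ∀ r, Commute (1 + p r • A) (y r) := fun r => by
    refine (Commute.one_left _).add_left ?_
    refine Commute.smul_left ?_ _
    exact (((Commute.refl A).smul_right t).smul_right _).exp_right
  have hypow : ∀ r, ∀ j : ℕ, (y r) ^ j = NormedSpace.exp ((j * (m r : ℝ)⁻¹) • t • A) := by
    intro r j
    let _ : NormedAlgebra ℚ 𝔸 := NormedAlgebra.restrictScalars ℚ ℝ 𝔸
    rw [hy, ← NormedSpace.exp_nsmul, ← Nat.cast_smul_eq_nsmul ℝ, smul_smul]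
  have hmain : ∀ᶠ r in atTop, ‖(1 + p r • A) ^ m r - NormedSpace.exp (t • A)‖ ≤
      ‖(m r * p r) • A - (m r : ℝ) • (y r - 1)‖ * (Real.exp (t * ‖A‖) * D) := by
    filter_upwards [hm.eventually_gt_atTop 0] with r hr
    have hr' : (0 : ℝ) < m r := Nat.cast_pos.2 hr
    have hym : NormedSpace.exp (t • A) = y r ^ m r := by
      rw [hypow, mul_inv_cancel₀ hr'.ne', one_smul]
    have hxy : (m r * p r) • A - (m r : ℝ) • (y r - 1) = (m r : ℝ) • (1 + p r • A - y r) := by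
      rw [mul_smul, ← smul_sub]; congr 1; abel
    rw [hym, ← (hcomm r).mul_geom_sum₂, hxy, norm_smul, Real.norm_of_nonneg hr'.le]
    have hsum : ‖∑ i ∈ Finset.range (m r), (1 + p r • A) ^ i * y r ^ (m r - 1 - i)‖ ≤
        m r * (Real.exp (t * ‖A‖) * D) := by
      refine (norm_sum_le_of_le _ (f := fun i => (1 + p r • A) ^ i * y r ^ (m r - 1 - i))
        (n := fun _ => Real.exp (t * ‖A‖) * D) fun i hi => ?_).trans (by simp)
      refine (norm_mul_le _ _).trans (mul_le_mul (hC r i (Finset.mem_range.1 hi).le) ?_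
        (norm_nonneg _) (Real.exp_pos _).le)
      rw [hypow]
      refine hD _ ⟨by positivity, ?_⟩
      rw [← div_eq_mul_inv, div_le_one hr']
      exact Nat.cast_le.2 (by omega)
    calc _ ≤ ‖1 + p r • A - y r‖ * (m r * (Real.exp (t * ‖A‖) * D)) :=
          (norm_mul_le _ _).trans (mul_le_mul_of_nonneg_left hsum (norm_nonneg _))
      _ = _ := by ring
  have hslope : Tendsto (fun r => (m r : ℝ) • (y r - 1)) atTop (𝓝 (t • A)) := by
    have hd := hasDerivAt_iff_tendsto_slope_zero.1 (hasDerivAt_exp_smul_const (t • A) (0 : ℝ))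
    simp only [zero_add, zero_smul, NormedSpace.exp_zero, one_mul] at hd
    have hinv : Tendsto (fun r => (m r : ℝ)⁻¹) atTop (𝓝[≠] 0) := by
      refine tendsto_nhdsWithin_iff.2
        ⟨tendsto_inv_atTop_zero.comp (tendsto_natCast_atTop_atTop.comp hm), ?_⟩
      filter_upwards [hm.eventually_gt_atTop 0] with r hr
      simpa using hr.ne'
    simpa [Function.comp_def] using hd.comp hinv
  have hzero : Tendsto (fun r => ‖(m r * p r) • A - (m r : ℝ) • (y r - 1)‖ *
      (Real.exp (t * ‖A‖) * D)) atTop (𝓝 0) := by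
    have := (((hmp.smul_const A).sub hslope).norm).mul_const (Real.exp (t * ‖A‖) * D)
    simpa using this
  rw [tendsto_iff_norm_sub_tendsto_zero]
  exact squeeze_zero' (Eventually.of_forall fun _ => norm_nonneg _) hmain hzero

section Limit

variable {ι Ω : Type*} [Fintype ι] [DecidableEq ι] [MeasurableSpace Ω] {μ : Measure Ω}
  {P : Matrix ι ι ℝ} {y₀ : ι → ℝ} {N : ι → ℝ≥0 → Ω → ℕ} {Y : ℝ≥0 → Ω → ι → ℝ}

/-- Almost surely the discretisation over a fine enough dyadic grid is exact, by the Borel–Cantelli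
lemma. -/
lemma IsSmoothingProcess.ae_eventually_eq_randomChain [IsProbabilityMeasure μ]
    (h : IsSmoothingProcess P y₀ N Y μ) (t : ℝ≥0) :
    ∀ᵐ ω ∂μ, ∀ᶠ r : ℕ in atTop, Y t ω = randomChain P y₀ N (t / 2 ^ r) (2 ^ r) ω := by
  set bad : ℕ → Set Ω := fun r => ⋃ l ∈ Finset.range (2 ^ r),
    {ω | ¬(ringCounts N (t / 2 ^ r) l ω = 0 ∨ ∃ k, ringCounts N (t / 2 ^ r) l ω = Pi.single k 1)}
    with hbad
  have hle : ∀ r, μ (bad r) ≤ ENNReal.ofReal ((Fintype.card ι * t) ^ 2 * (1 / 2) ^ r) := by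
    intro r
    rw [← ofReal_measureReal (measure_ne_top _ _)]
    refine ENNReal.ofReal_le_ofReal ?_
    refine (measureReal_biUnion_finset_le _ _).trans
      ((Finset.sum_le_sum fun l _ => measureReal_two_rings_le h.clocks _ l).trans (le_of_eq ?_))
    simp only [Finset.sum_const, Finset.card_range, nsmul_eq_mul]
    push_cast
    rw [one_div, inv_pow]
    field_simp
  have hsum : ∑' r, μ (bad r) ≠ ⊤ := by
    refine ne_top_of_le_ne_top ?_ (ENNReal.tsum_le_tsum hle)
    exact ((summable_geometric_of_lt_one (by norm_num) (by norm_num)).mul_left _).tsum_ofReal_ne_top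
  have hmono : ∀ᵐ ω ∂μ, ∀ i, Monotone fun t => N i t ω :=
    ae_all_iff.2 fun i => (h.clocks.poisson i).mono
  have hrc : ∀ᵐ ω ∂μ, ∀ i, ∀ t, ContinuousWithinAt (fun s => N i s ω) (Set.Ici t) t :=
    ae_all_iff.2 fun i => (h.clocks.poisson i).right_cont
  filter_upwards [ae_eventually_notMem hsum, hmono, hrc, h.start, h.no_ring, h.ring]
    with ω hω hmono hrc hstart hno hring
  filter_upwards [hω] with r hr
  have hgrid := eq_stepChain_of_grid (c := fun i s => N i s ω) (y := fun s => Y s ω)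
    (τ := fun l : ℕ => (l : ℝ≥0) * (t / 2 ^ r)) (m := 2 ^ r) hstart hmono hrc hno hring (by simp)
    (monotone_natCast_mul _) fun l hl => by
      by_contra hcon
      exact hr (Set.mem_biUnion (Finset.mem_coe.2 (Finset.mem_range.2 hl)) hcon)
  have ht : ((2 ^ r : ℕ) : ℝ≥0) * (t / 2 ^ r) = t := by
    push_cast
    field_simp
  simp only [ht] at hgrid
  exact hgrid

/-- Continuous functions of the mass distribution are integrable. The measurability is part of the
claim: `Y` is not assumed to be measurable. -/
lemma IsSmoothingProcess.integrable_comp {E : Type*} [NormedAddCommGroup E] [IsProbabilityMeasure μ]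
    (h : IsSmoothingProcess P y₀ N Y μ) (hP : ∀ i, ∑ j, |P i j| ≤ 1) {f : (ι → ℝ) → E}
    (hf : Continuous f) (t : ℝ≥0) : Integrable (fun ω => f (Y t ω)) μ := by
  obtain ⟨B, hB⟩ := exists_norm_le_of_abs_le hf ‖y₀‖
  have hev := h.ae_eventually_eq_randomChain t
  refine Integrable.of_bound (aestronglyMeasurable_of_tendsto_ae atTop
    (fun r => (integrable_comp_randomChain hP y₀ h.clocks hf (t / 2 ^ r) (2 ^ r)).1) ?_) B ?_
  · filter_upwards [hev] with ω hω
    exact tendsto_const_nhds.congr' (hω.mono fun r hr => by rw [hr])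
  · filter_upwards [hev] with ω hω
    obtain ⟨r, hr⟩ := hω.exists
    rw [hr]
    exact hB _ fun i => abs_stepChain_le hP (fun j => norm_le_pi_norm y₀ j) _ _ _

/-- If the increments of `f` under the updates sum to a linear function `A` of `f`, then the
expectation of `f` solves the linear equation `u' = A u`. -/
theorem IsSmoothingProcess.integral_comp_eq_exp {E : Type*} [NormedAddCommGroup E]
    [NormedSpace ℝ E] [IsProbabilityMeasure μ] [CompleteSpace E]
    (h : IsSmoothingProcess P y₀ N Y μ) (hP : ∀ i, ∑ j, |P i j| ≤ 1) {f : (ι → ℝ) → E}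
    (hf : Continuous f) {A : E →L[ℝ] E}
    (hA : ∀ y, ∑ k, (f (ringUpdate P k y) - f y) = A (f y)) (t : ℝ≥0) :
    ∫ ω, f (Y t ω) ∂μ = NormedSpace.exp ((t : ℝ) • A) (f y₀) := by
  obtain ⟨B, hB⟩ := exists_norm_le_of_abs_le hf ‖y₀‖
  have hlim : Tendsto (fun r : ℕ => ∫ ω, f (randomChain P y₀ N (t / 2 ^ r) (2 ^ r) ω) ∂μ) atTop
      (𝓝 (∫ ω, f (Y t ω) ∂μ)) := by
    refine tendsto_integral_of_dominated_convergence (fun _ => B)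
      (fun r => (integrable_comp_randomChain hP y₀ h.clocks hf _ _).1) (integrable_const _)
      (fun r => ae_of_all _ fun ω => hB _ fun i =>
        abs_stepChain_le hP (fun j => norm_le_pi_norm y₀ j) _ _ _) ?_
    filter_upwards [h.ae_eventually_eq_randomChain t] with ω hω
    exact tendsto_const_nhds.congr' (hω.mono fun r hr => by rw [hr])
  simp only [integral_comp_randomChain hP y₀ h.clocks hf hA] at hlim
  set p : ℕ → ℝ := fun r =>
    ((t / 2 ^ r : ℝ≥0) : ℝ) * Real.exp (-(Fintype.card ι * ((t / 2 ^ r : ℝ≥0) : ℝ))) with hp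
  have hmp : ∀ r, ((2 ^ r : ℕ) : ℝ) * p r =
      t * Real.exp (-(Fintype.card ι * (t * (1 / 2) ^ r))) := by
    intro r
    simp only [hp]
    push_cast
    rw [← mul_assoc, one_div, inv_pow]
    congr 2
    field_simp
  have hexp := tendsto_one_add_smul_pow_exp (𝔸 := E →L[ℝ] E)
    (ContinuousLinearMap.norm_id_le) A (t := t) (m := fun r => 2 ^ r)
    (tendsto_pow_atTop_atTop_of_one_lt (by norm_num)) (p := p)
    (fun r => by positivity)
    (fun r => by
      rw [hmp]
      refine mul_le_of_le_one_right t.2 (Real.exp_le_one_iff.2 (neg_nonpos.2 ?_))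
      have := t.2
      positivity)
    (by
      simp only [hmp]
      have h0 : Tendsto (fun r : ℕ => ((1 : ℝ) / 2) ^ r) atTop (𝓝 0) :=
        tendsto_pow_atTop_nhds_zero_of_lt_one (by norm_num) (by norm_num)
      have := ((Real.continuous_exp.tendsto _).comp
        (((h0.const_mul (t : ℝ)).const_mul (Fintype.card ι : ℝ)).neg)).const_mul (t : ℝ)
      simpa [Function.comp_def] using this)
  exact tendsto_nhds_unique hlim
    (((ContinuousLinearMap.apply ℝ E (f y₀)).continuous.tendsto _).comp hexp)

end Limit

/-! ### Fourier analysis on the torus -/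

section Fourier

variable {d n : ℕ} [NeZero n]

/-- The character `x ↦ exp (2 π i (k ⬝ x) / n)` of the torus. -/
noncomputable def torusChar (k x : Torus d n) : ℂ := ZMod.stdAddChar (k ⬝ᵥ x)

/-- The Fourier coefficient `∑ x, exp (2 π i (k ⬝ x) / n) y x`, without normalisation. -/
noncomputable def torusFourier (k : Torus d n) (y : Torus d n → ℝ) : ℂ :=
  ∑ x, torusChar k x * y x

/-- The eigenvalue `d⁻¹ ∑ j, (1 - cos (2 π k_j / n))` of `1 - P`, for simple random walk `P` on the
torus, at the character with frequency `k`. -/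
noncomputable def torusEigenvalue (k : Torus d n) : ℝ :=
  (d : ℝ)⁻¹ * ∑ j, (1 - Real.cos (2 * Real.pi * (k j).val / n))

lemma torusChar_add (k x z : Torus d n) :
    torusChar k (x + z) = torusChar k x * torusChar k z := by
  rw [torusChar, dotProduct_add, AddChar.map_add_eq_mul]; rfl

lemma torusChar_zero_right (k : Torus d n) : torusChar k 0 = 1 := by
  simp [torusChar]

lemma conj_torusChar (k x : Torus d n) : starRingEnd ℂ (torusChar k x) = torusChar k (-x) := by
  rw [torusChar, torusChar, dotProduct_neg, ZMod.stdAddChar_apply, ZMod.stdAddChar_apply,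
    AddChar.map_neg_eq_inv, Circle.coe_inv_eq_conj]

lemma norm_torusChar (k x : Torus d n) : ‖torusChar k x‖ = 1 := by
  rw [torusChar, ZMod.stdAddChar_apply, Circle.norm_coe]

lemma sum_torusChar (x : Torus d n) :
    ∑ k, torusChar k x = if x = 0 then (n : ℂ) ^ d else 0 := by
  classical
  split_ifs with h
  · subst h
    simp [torusChar_zero_right, ZMod.card]
  · obtain ⟨j, hj⟩ := Function.ne_iff.1 h
    set ψ : AddChar (Torus d n) ℂ := ZMod.stdAddChar.compAddMonoidHom
      { toFun := fun k => k ⬝ᵥ x, map_zero' := zero_dotProduct x,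
        map_add' := fun a b => add_dotProduct a b x } with hψ
    refine AddChar.sum_eq_zero_of_ne_one (ψ := ψ) fun h1 => hj ?_
    have h2 := DFunLike.congr_fun h1 (Pi.single j 1)
    simp only [hψ, AddChar.compAddMonoidHom_apply, AddMonoidHom.coe_mk, ZeroHom.coe_mk,
      single_one_dotProduct, AddChar.one_apply] at h2
    rw [← AddChar.map_zero_eq_one (ZMod.stdAddChar (N := n))] at h2
    exact ZMod.injective_stdAddChar h2

lemma sum_conj_torusFourier_mul (y z : Torus d n → ℝ) :
    ∑ k, starRingEnd ℂ (torusFourier k y) * torusFourier k z =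
      (n : ℂ) ^ d * ((∑ x, y x * z x : ℝ) : ℂ) := by
  have h : ∀ k, starRingEnd ℂ (torusFourier k y) * torusFourier k z =
      ∑ x, ∑ x', ((y x : ℂ) * z x') * torusChar k (x' - x) := by
    intro k
    rw [torusFourier, torusFourier, map_sum, Finset.sum_mul_sum]
    refine Finset.sum_congr rfl fun x _ => Finset.sum_congr rfl fun x' _ => ?_
    rw [map_mul, conj_torusChar, Complex.conj_ofReal, sub_eq_add_neg, torusChar_add]
    ring
  simp only [h]
  rw [Finset.sum_comm]
  have h2 : ∀ x, ∑ k, ∑ x', ((y x : ℂ) * z x') * torusChar k (x' - x) =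
      (n : ℂ) ^ d * (y x * z x) := by
    intro x
    rw [Finset.sum_comm]
    simp only [← Finset.mul_sum, sum_torusChar, sub_eq_zero, mul_ite, mul_zero]
    simp [mul_comm]
  simp only [h2]
  push_cast
  rw [Finset.mul_sum]

lemma sum_norm_torusFourier_sq (y : Torus d n → ℝ) :
    ∑ k, ‖torusFourier k y‖ ^ 2 = (n : ℝ) ^ d * ∑ x, y x ^ 2 := by
  have h := sum_conj_torusFourier_mul y y
  simp only [Complex.conj_mul'] at h
  have : ∑ x, y x ^ 2 = ∑ x, y x * y x := Finset.sum_congr rfl fun x _ => sq (y x)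
  rw [this]
  exact_mod_cast h

lemma torusFourier_sub (k : Torus d n) (y z : Torus d n → ℝ) :
    torusFourier k (fun x => y x - z x) = torusFourier k y - torusFourier k z := by
  simp only [torusFourier, Complex.ofReal_sub, mul_sub, Finset.sum_sub_distrib]

lemma torusFourier_shift (k z : Torus d n) (y : Torus d n → ℝ) :
    torusFourier k (fun x => y (x + z)) = torusChar k (-z) * torusFourier k y := by
  rw [torusFourier, torusFourier, Finset.mul_sum]
  refine Fintype.sum_equiv (Equiv.addRight z) _ _ fun x => ?_
  rw [Equiv.coe_addRight, torusChar_add, ← mul_assoc, ← mul_assoc, mul_comm (torusChar k (-z)),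
    mul_assoc (torusChar k x), ← torusChar_add, neg_add_cancel, torusChar_zero_right, mul_one]

lemma torusChar_single_add_neg (k : Torus d n) (j : Fin d) :
    torusChar k (Pi.single j 1) + torusChar k (-Pi.single j 1) =
      ((2 * Real.cos (2 * Real.pi * (k j).val / n) : ℝ) : ℂ) := by
  rw [← conj_torusChar, Complex.add_conj, torusChar, dotProduct_single_one, ZMod.stdAddChar_apply,
    ZMod.toCircle_eq_circleExp, Circle.coe_exp, Complex.exp_ofReal_mul_I_re, mul_div_assoc]

section Graph

lemma torus_single_ne_neg_single {d n : ℕ} (hn : 3 ≤ n) (i j : Fin d) :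
    (Pi.single i 1 : Torus d n) ≠ -Pi.single j 1 := by
  have : Fact (1 < n) := ⟨by omega⟩
  intro h
  have h1 := congrFun h i
  by_cases hij : i = j
  · subst hij
    simp only [Pi.single_eq_same, Pi.neg_apply] at h1
    have h2 : ((2 : ℕ) : ZMod n) = 0 := by
      push_cast
      linear_combination h1
    rw [ZMod.natCast_eq_zero_iff] at h2
    have := Nat.le_of_dvd (by norm_num) h2
    omega
  · simp [hij] at h1

lemma torus_single_injective {d n : ℕ} (hn : 3 ≤ n) :
    Function.Injective fun i : Fin d => (Pi.single i 1 : Torus d n) := by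
  have : Fact (1 < n) := ⟨by omega⟩
  intro i j h
  by_contra hij
  have := congrFun h i
  simp [hij] at this

open scoped Classical in
/-- For `n ≥ 3` the neighbours of `x` are the `2 d` distinct sites `x + e_j` and `x - e_j`. -/
lemma sum_torusGraph_adj {M : Type*} [AddCommMonoid M] (hn : 3 ≤ n) (x : Torus d n)
    (f : Torus d n → M) :
    (∑ y, if (torusGraph d n).Adj x y then f y else 0) =
      ∑ j, (f (x + Pi.single j 1) + f (x - Pi.single j 1)) := by
  have : Fact (1 < n) := ⟨by omega⟩
  set g : Fin d ⊕ Fin d → Torus d n :=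
    Sum.elim (fun j => x + Pi.single j 1) (fun j => x - Pi.single j 1) with hg
  have hinj : Function.Injective g := by
    rintro (i | i) (j | j) h
    · simpa using torus_single_injective hn (add_left_cancel h)
    · exact absurd (add_left_cancel (h.trans (sub_eq_add_neg _ _)))
        (torus_single_ne_neg_single hn i j)
    · exact absurd (add_left_cancel (h.symm.trans (sub_eq_add_neg _ _)))
        (torus_single_ne_neg_single hn j i)
    · simpa using torus_single_injective hn (sub_right_injective h)
  have hset : Finset.univ.filter (fun y => (torusGraph d n).Adj x y) =
      Finset.univ.map ⟨g, hinj⟩ := by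
    ext y
    simp only [Finset.mem_filter, Finset.mem_univ, true_and, Finset.mem_map,
      Function.Embedding.coeFn_mk, torusGraph, SimpleGraph.circulantGraph_adj, Set.mem_range]
    constructor
    · rintro ⟨-, ⟨j, hj⟩ | ⟨j, hj⟩⟩
      · exact ⟨Sum.inr j, by simp [hg, hj]⟩
      · exact ⟨Sum.inl j, by simp [hg, hj]⟩
    · have hne : ∀ j : Fin d, (Pi.single j 1 : Torus d n) ≠ 0 := fun j h => by
        simpa using congrFun h j
      rintro ⟨j | j, rfl⟩
      · exact ⟨by simp [hg, hne], Or.inr ⟨j, by simp [hg]⟩⟩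
      · refine ⟨?_, Or.inl ⟨j, by simp [hg]⟩⟩
        simp only [hg, Sum.elim_inr]
        intro h
        exact hne j (by simpa using h.symm)
  rw [← Finset.sum_filter, hset, Finset.sum_map]
  simp [hg, Fintype.sum_sum_type, Finset.sum_add_distrib]

lemma torusGraph_degree (hn : 3 ≤ n) (x : Torus d n)
    [Fintype ((torusGraph d n).neighborSet x)] : (torusGraph d n).degree x = 2 * d := by
  classical
  have h := sum_torusGraph_adj hn x fun _ => (1 : ℕ)
  rw [← Finset.card_filter] at h
  rw [SimpleGraph.degree]
  simp only [Finset.sum_const, Finset.card_univ, Fintype.card_fin, smul_eq_mul] at h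
  rw [show (2 : ℕ) * d = d * (1 + 1) by ring, ← h]
  congr 1
  ext y
  simp

lemma sum_srwMatrix_mul (hn : 3 ≤ n) (x : Torus d n) (y : Torus d n → ℝ) :
    ∑ z, srwMatrix (torusGraph d n) x z * y z =
      (2 * d : ℝ)⁻¹ * ∑ j, (y (x + Pi.single j 1) + y (x - Pi.single j 1)) := by
  classical
  rw [← sum_torusGraph_adj hn x y, Finset.mul_sum]
  refine Finset.sum_congr rfl fun z _ => ?_
  rw [srwMatrix, torusGraph_degree hn]
  split_ifs <;> simp

lemma sum_abs_srwMatrix_le (hn : 3 ≤ n) (x : Torus d n) :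
    ∑ z, |srwMatrix (torusGraph d n) x z| ≤ 1 := by
  have h : ∀ z, |srwMatrix (torusGraph d n) x z| = srwMatrix (torusGraph d n) x z * 1 := fun z => by
    rw [mul_one, abs_of_nonneg]
    unfold srwMatrix
    split_ifs <;> positivity
  simp only [h, sum_srwMatrix_mul hn x fun _ => 1]
  rcases Nat.eq_zero_or_pos d with rfl | hd
  · simp
  · have : (0 : ℝ) < d := Nat.cast_pos.2 hd
    simp only [Finset.sum_const, Finset.card_univ, Fintype.card_fin, nsmul_eq_mul]
    exact le_of_eq (by field_simp; norm_num)

end Graph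

/-- The Laplacian `(1 - P) y` of simple random walk on the torus. -/
noncomputable def torusLaplacian (y : Torus d n → ℝ) (x : Torus d n) : ℝ :=
  y x - ∑ z, srwMatrix (torusGraph d n) x z * y z

lemma torusFourier_torusLaplacian (hd : 1 ≤ d) (hn : 3 ≤ n) (k : Torus d n) (y : Torus d n → ℝ) :
    torusFourier k (torusLaplacian y) = torusEigenvalue k * torusFourier k y := by
  have hd0 : (d : ℂ) ≠ 0 := Nat.cast_ne_zero.2 (by omega)
  have h1 : torusFourier k (fun x => ∑ z, srwMatrix (torusGraph d n) x z * y z) =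
      (2 * d : ℂ)⁻¹ * ∑ j, (torusFourier k (fun x => y (x + Pi.single j 1)) +
        torusFourier k (fun x => y (x + -Pi.single j 1))) := by
    simp only [sum_srwMatrix_mul hn, torusFourier, ← sub_eq_add_neg]
    push_cast
    simp only [← Finset.sum_add_distrib, ← mul_add]
    rw [Finset.sum_comm, Finset.mul_sum]
    refine Finset.sum_congr rfl fun x _ => ?_
    rw [← Finset.mul_sum]; ring
  have h2 : torusFourier k (torusLaplacian y) = torusFourier k y -
      torusFourier k (fun x => ∑ z, srwMatrix (torusGraph d n) x z * y z) :=
    torusFourier_sub k _ _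
  rw [h2, h1]
  simp only [torusFourier_shift, neg_neg, ← add_mul]
  rw [← Finset.sum_mul]
  have h3 : ∑ j, (torusChar k (-Pi.single j 1) + torusChar k (Pi.single j 1)) =
      ((∑ j, 2 * Real.cos (2 * Real.pi * (k j).val / n) : ℝ) : ℂ) := by
    rw [Complex.ofReal_sum]
    exact Finset.sum_congr rfl fun j _ => by rw [add_comm, torusChar_single_add_neg]
  rw [h3, torusEigenvalue, Finset.sum_sub_distrib, ← Finset.mul_sum]
  push_cast
  simp only [Finset.sum_const, Finset.card_univ, Fintype.card_fin, nsmul_eq_mul, mul_one]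
  field_simp

end Fourier

/-! ### The expected power spectrum -/

section Power

variable {d n : ℕ} [NeZero n]

/-- The power spectrum `k ↦ |ŷ_k|²` of a mass distribution. -/
noncomputable def torusPower (y : Torus d n → ℝ) (k : Torus d n) : ℝ := ‖torusFourier k y‖ ^ 2

lemma continuous_torusPower : Continuous (torusPower : (Torus d n → ℝ) → Torus d n → ℝ) := by
  unfold torusPower torusFourier
  fun_prop

/-- The generator of the evolution of the expected power spectrum of the smoothing process. -/
noncomputable def powerGenerator (d n : ℕ) [NeZero n] :
    (Torus d n → ℝ) →L[ℝ] (Torus d n → ℝ) :=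
  LinearMap.toContinuousLinearMap
    { toFun := fun g k => -2 * torusEigenvalue k * g k +
        ((n : ℝ) ^ d)⁻¹ * ∑ l : Torus d n, torusEigenvalue l ^ 2 * g l
      map_add' := fun g g' => by
        funext k
        simp only [Pi.add_apply, mul_add, Finset.sum_add_distrib]
        ring
      map_smul' := fun c g => by
        funext k
        simp only [Pi.smul_apply, smul_eq_mul, RingHom.id_apply, mul_left_comm _ c,
          ← Finset.mul_sum]
        ring }

lemma powerGenerator_apply (g : Torus d n → ℝ) (k : Torus d n) :
    powerGenerator d n g k = -2 * torusEigenvalue k * g k +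
        ((n : ℝ) ^ d)⁻¹ * ∑ l : Torus d n, torusEigenvalue l ^ 2 * g l := rfl

lemma torusFourier_ringUpdate (k i : Torus d n) (y : Torus d n → ℝ) :
    torusFourier k (ringUpdate (srwMatrix (torusGraph d n)) i y) =
      torusFourier k y - torusChar k i * torusLaplacian y i := by
  have h : ringUpdate (srwMatrix (torusGraph d n)) i y =
      fun x => y x - Pi.single (M := fun _ => ℝ) i (torusLaplacian y i) x := by
    funext x
    by_cases hx : x = i
    · subst hx; simp [ringUpdate, torusLaplacian]
    · simp [ringUpdate, hx]
  rw [h, torusFourier_sub]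
  congr 1
  rw [torusFourier, Finset.sum_eq_single i]
  · simp
  · intro x _ hx; simp [hx]
  · simp

/-- The total change of the power spectrum, if every clock rings once from the same state, is a
linear function of the power spectrum: the linear terms in the updates are diagonal in Fourier
space, and the quadratic terms sum to `‖(1 - P) y‖²` in each mode. -/
lemma sum_torusPower_ringUpdate (hd : 1 ≤ d) (hn : 3 ≤ n) (y : Torus d n → ℝ) :
    ∑ i, (torusPower (ringUpdate (srwMatrix (torusGraph d n)) i y) - torusPower y) =
      powerGenerator d n (torusPower y) := by
  have hn0 : ((n : ℝ) ^ d) ≠ 0 := pow_ne_zero _ (Nat.cast_ne_zero.2 (by omega))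
  funext k
  have hterm : ∀ i, torusPower (ringUpdate (srwMatrix (torusGraph d n)) i y) k - torusPower y k =
      -2 * (starRingEnd ℂ (torusFourier k y) * (torusChar k i * torusLaplacian y i)).re +
        torusLaplacian y i ^ 2 := by
    intro i
    rw [torusPower, torusPower, torusFourier_ringUpdate, ← Complex.normSq_eq_norm_sq,
      ← Complex.normSq_eq_norm_sq, Complex.normSq_sub, Complex.normSq_mul, Complex.normSq_ofReal,
      Complex.normSq_eq_norm_sq (torusChar k i), norm_torusChar,
      ← Complex.conj_re (torusFourier k y * _), map_mul, Complex.conj_conj]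
    ring
  have hcross : ∑ i, starRingEnd ℂ (torusFourier k y) * (torusChar k i * torusLaplacian y i) =
      ((torusEigenvalue k * torusPower y k : ℝ) : ℂ) := by
    rw [← Finset.mul_sum]
    change starRingEnd ℂ (torusFourier k y) * torusFourier k (torusLaplacian y) = _
    rw [torusFourier_torusLaplacian hd hn, mul_left_comm, Complex.conj_mul', torusPower]
    push_cast; rfl
  have hquad : ∑ i, torusLaplacian y i ^ 2 =
      ((n : ℝ) ^ d)⁻¹ * ∑ l : Torus d n, torusEigenvalue l ^ 2 * torusPower y l := by
    rw [eq_inv_mul_iff_mul_eq₀ hn0, ← sum_norm_torusFourier_sq]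
    refine Finset.sum_congr rfl fun l _ => ?_
    rw [torusFourier_torusLaplacian hd hn, norm_mul, mul_pow, Complex.norm_real, Real.norm_eq_abs,
      sq_abs, torusPower]
  rw [Finset.sum_apply]
  simp only [Pi.sub_apply, hterm]
  rw [Finset.sum_add_distrib, ← Finset.mul_sum, ← Complex.re_sum, hcross, hquad,
    powerGenerator_apply, Complex.ofReal_re, mul_assoc]

lemma torusPower_single_zero : torusPower (Pi.single 0 1 : Torus d n → ℝ) = fun _ => 1 := by
  funext k
  rw [torusPower, torusFourier, Finset.sum_eq_single 0]
  · simp [torusChar_zero_right]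
  · intro x _ hx; simp [hx]
  · simp

lemma torusEnergy_eq (hd : 1 ≤ d) (hn : 3 ≤ n) (y : Torus d n → ℝ) :
    torusEnergy d n y =
      ((n : ℝ) ^ d)⁻¹ * (((n : ℝ) ^ d)⁻¹ * ∑ k, torusEigenvalue k * torusPower y k) := by
  classical
  have hn0 : ((n : ℝ) ^ d) ≠ 0 := pow_ne_zero _ (Nat.cast_ne_zero.2 (by omega))
  have hd0 : (d : ℝ) ≠ 0 := Nat.cast_ne_zero.2 (by omega)
  have hdir : ∑ k, torusEigenvalue k * torusPower y k =
      (n : ℝ) ^ d * ∑ x, y x * torusLaplacian y x := by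
    have h := sum_conj_torusFourier_mul y (torusLaplacian y)
    simp only [torusFourier_torusLaplacian hd hn, mul_left_comm _ ((torusEigenvalue _ : ℝ) : ℂ),
      Complex.conj_mul'] at h
    exact_mod_cast h
  have hshift : ∀ z : Torus d n, ∑ x, y (x + z) ^ 2 = ∑ x, y x ^ 2 := fun z =>
    Fintype.sum_equiv (Equiv.addRight z) _ _ fun x => rfl
  have hsum : ∑ x, ∑ z, (if (torusGraph d n).Adj x z then (y x - y z) ^ 2 else 0) =
      4 * d * ∑ x, y x * torusLaplacian y x := by
    have h1 : ∀ x, ∑ z, (if (torusGraph d n).Adj x z then (y x - y z) ^ 2 else 0) =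
        4 * d * (y x * torusLaplacian y x) + ∑ j, ((y (x + Pi.single j 1) ^ 2 - y x ^ 2) +
          (y (x + -Pi.single j 1) ^ 2 - y x ^ 2)) := by
      intro x
      rw [sum_torusGraph_adj hn x fun z => (y x - y z) ^ 2, torusLaplacian,
        sum_srwMatrix_mul hn x]
      simp only [← sub_eq_add_neg]
      have h2 : 4 * d * (y x * (y x - (2 * d : ℝ)⁻¹ *
          ∑ j, (y (x + Pi.single j 1) + y (x - Pi.single j 1)))) =
          ∑ j : Fin d, (4 * y x ^ 2 -
            2 * y x * (y (x + Pi.single j 1) + y (x - Pi.single j 1))) := by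
        simp only [Finset.sum_sub_distrib, ← Finset.mul_sum, Finset.sum_const, Finset.card_univ,
          Fintype.card_fin, nsmul_eq_mul]
        field_simp
        ring
      rw [h2, ← Finset.sum_add_distrib]
      refine Finset.sum_congr rfl fun j _ => ?_
      ring
    simp only [h1]
    rw [Finset.sum_add_distrib, ← Finset.mul_sum,
      Finset.sum_comm (s := Finset.univ (α := Torus d n))]
    simp only [Finset.sum_add_distrib, Finset.sum_sub_distrib, hshift]
    simp
  rw [torusEnergy, hdir, hsum]
  field_simp

lemma torusVariance_eq (y : Torus d n → ℝ) :
    torusVariance d n y =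
      ((n : ℝ) ^ d)⁻¹ * (((n : ℝ) ^ d)⁻¹ * ∑ k with k ≠ 0, torusPower y k) := by
  have hn0 : ((n : ℝ) ^ d) ≠ 0 := pow_ne_zero _ (Nat.cast_ne_zero.2 (NeZero.ne n))
  have h0 : torusPower y 0 = (∑ x, y x) ^ 2 := by
    rw [torusPower, torusFourier]
    simp only [torusChar, zero_dotProduct, AddChar.map_zero_eq_one, one_mul]
    rw [← Complex.ofReal_sum, Complex.norm_real, Real.norm_eq_abs, sq_abs]
  have h1 : ∑ k with k ≠ 0, torusPower y k = (n : ℝ) ^ d * ∑ x, y x ^ 2 - (∑ x, y x) ^ 2 := by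
    rw [← sum_norm_torusFourier_sq, ← h0, eq_sub_iff_add_eq,
      ← Finset.sum_filter_add_sum_filter_not Finset.univ (fun k : Torus d n => k ≠ 0)]
    congr 1
    simp only [not_not, Finset.filter_eq', Finset.mem_univ, if_true, Finset.sum_singleton]
    rfl
  rw [torusVariance, varianceFunctional, h1, ← Finset.mul_sum, ← Finset.mul_sum]
  simp only [sub_sq, Finset.sum_add_distrib, Finset.sum_sub_distrib, ← Finset.mul_sum,
    ← Finset.sum_mul, Finset.sum_const, Finset.card_univ, nsmul_eq_mul]
  rw [show Fintype.card (Torus d n) = n ^ d by simp [ZMod.card]]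
  push_cast
  field_simp
  ring

/-- The expected power spectrum at time `t` of the smoothing process started from a unit mass at the
origin. -/
noncomputable def expectedPower (d n : ℕ) [NeZero n] (k : Torus d n) (t : ℝ) : ℝ :=
  NormedSpace.exp (t • powerGenerator d n) (fun _ => 1) k

lemma expectedPower_zero (k : Torus d n) : expectedPower d n k 0 = 1 := by
  simp [expectedPower]

lemma hasDerivAt_expectedPower (k : Torus d n) (t : ℝ) :
    HasDerivAt (expectedPower d n k) (-2 * torusEigenvalue k * expectedPower d n k t +
      ((n : ℝ) ^ d)⁻¹ * ∑ l, torusEigenvalue l ^ 2 * expectedPower d n l t) t := by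
  have h := hasDerivAt_exp_smul_const' (powerGenerator d n) t
  have h2 := ((ContinuousLinearMap.proj (R := ℝ) (φ := fun _ : Torus d n => ℝ) k).comp
    (ContinuousLinearMap.apply ℝ (Torus d n → ℝ) (fun _ => 1))).hasFDerivAt.comp_hasDerivAt t h
  exact h2

variable {Ω : Type*} [MeasurableSpace Ω] {μ : Measure Ω} [IsProbabilityMeasure μ]
  {N : Torus d n → ℝ≥0 → Ω → ℕ} {Y : ℝ≥0 → Ω → Torus d n → ℝ}

lemma IsSmoothingProcess.integrable_torusPower (hn : 3 ≤ n)
    (h : IsSmoothingProcess (srwMatrix (torusGraph d n)) (Pi.single 0 1) N Y μ) (t : ℝ≥0)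
    (k : Torus d n) : Integrable (fun ω => torusPower (Y t ω) k) μ :=
  h.integrable_comp (sum_abs_srwMatrix_le hn)
    ((continuous_apply k).comp continuous_torusPower) t

lemma IsSmoothingProcess.integral_torusPower (hd : 1 ≤ d) (hn : 3 ≤ n)
    (h : IsSmoothingProcess (srwMatrix (torusGraph d n)) (Pi.single 0 1) N Y μ) (t : ℝ≥0)
    (k : Torus d n) : ∫ ω, torusPower (Y t ω) k ∂μ = expectedPower d n k t := by
  rw [expectedPower, ← torusPower_single_zero,
    ← h.integral_comp_eq_exp (sum_abs_srwMatrix_le hn) continuous_torusPower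
      (sum_torusPower_ringUpdate hd hn) t]
  rw [eval_integral fun l => h.integrable_torusPower hn t l]

end Power

/-! ### The renewal equation -/

section Renewal

/-- The weighted quadratic energy `c ∑ k, λ_k² G_k(t)`, which feeds every mode of a
`PowerEvolution`. -/
noncomputable def powerSource {κ : Type*} [Fintype κ] (lam : κ → ℝ) (c : ℝ) (G : κ → ℝ → ℝ)
    (t : ℝ) : ℝ :=
  c * ∑ k, lam k ^ 2 * G k t

/-- The kernel `c ∑ k, λ_k² exp (-2 λ_k t)` of the renewal equation for `powerSource`. -/
noncomputable def renewalKernel {κ : Type*} [Fintype κ] (lam : κ → ℝ) (c : ℝ) (t : ℝ) : ℝ :=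
  c * ∑ k, lam k ^ 2 * Real.exp (-2 * lam k * t)

/-- The system `G_k' = -2 λ_k G_k + φ`, `G_k(0) = 1`, `G_k ≥ 0` on `[0, ∞)`, where
`φ = c ∑ k, λ_k² G_k`, which the expected power spectrum of the smoothing process solves. The
weights are normalised by `c ∑ k, λ_k = 1`. -/
structure PowerEvolution {κ : Type*} [Fintype κ] (lam : κ → ℝ) (c : ℝ) (G : κ → ℝ → ℝ) :
    Prop where
  weight_nonneg : 0 ≤ c
  lam_nonneg : ∀ k, 0 ≤ lam k
  hasDerivAt : ∀ k t, HasDerivAt (G k) (-2 * lam k * G k t + powerSource lam c G t) t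
  init : ∀ k, G k 0 = 1
  nonneg : ∀ k t, 0 ≤ t → 0 ≤ G k t
  weight_sum : c * ∑ k, lam k = 1

namespace PowerEvolution

variable {κ : Type*} [Fintype κ] {lam : κ → ℝ} {c : ℝ} {G : κ → ℝ → ℝ}

lemma continuous_mode (h : PowerEvolution lam c G) (k : κ) : Continuous (G k) :=
  continuous_iff_continuousAt.2 fun t => (h.hasDerivAt k t).continuousAt

lemma continuous_source (h : PowerEvolution lam c G) : Continuous (powerSource lam c G) :=
  continuous_const.mul (continuous_finsetSum _ fun k _ =>
    continuous_const.mul (h.continuous_mode k))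

lemma continuous_kernel (lam : κ → ℝ) (c : ℝ) : Continuous (renewalKernel lam c) := by
  unfold renewalKernel
  fun_prop

lemma source_nonneg (h : PowerEvolution lam c G) {t : ℝ} (ht : 0 ≤ t) :
    0 ≤ powerSource lam c G t :=
  mul_nonneg h.weight_nonneg
    (Finset.sum_nonneg fun k _ => mul_nonneg (sq_nonneg _) (h.nonneg k t ht))

lemma kernel_nonneg (h : PowerEvolution lam c G) (t : ℝ) : 0 ≤ renewalKernel lam c t :=
  mul_nonneg h.weight_nonneg
    (Finset.sum_nonneg fun _ _ => mul_nonneg (sq_nonneg _) (Real.exp_pos _).le)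

/-- Duhamel's formula. -/
lemma mode_eq (h : PowerEvolution lam c G) (k : κ) (t : ℝ) :
    G k t = Real.exp (-2 * lam k * t) +
      ∫ s in (0 : ℝ)..t, powerSource lam c G s * Real.exp (-2 * lam k * (t - s)) := by
  have hd : ∀ s, HasDerivAt (fun s => Real.exp (-2 * lam k * (t - s)) * G k s)
      (powerSource lam c G s * Real.exp (-2 * lam k * (t - s))) s := by
    intro s
    have h1 : HasDerivAt (fun s => -2 * lam k * (t - s)) (2 * lam k) s := by
      have := ((hasDerivAt_id s).const_sub t).const_mul (-2 * lam k)
      exact this.congr_deriv (by ring)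
    refine (h1.exp.mul (h.hasDerivAt k s)).congr_deriv ?_
    ring
  have hc := h.continuous_source
  rw [intervalIntegral.integral_eq_sub_of_hasDerivAt (fun s _ => hd s)
    (Continuous.intervalIntegrable (by fun_prop) _ _)]
  simp [h.init]

lemma exp_le_mode (h : PowerEvolution lam c G) (k : κ) {t : ℝ} (ht : 0 ≤ t) :
    Real.exp (-2 * lam k * t) ≤ G k t := by
  rw [h.mode_eq k t]
  refine le_add_of_nonneg_right (intervalIntegral.integral_nonneg ht fun s hs => ?_)
  exact mul_nonneg (h.source_nonneg hs.1) (Real.exp_pos _).le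

/-- The renewal equation for the source. -/
lemma source_eq (h : PowerEvolution lam c G) (t : ℝ) :
    powerSource lam c G t = renewalKernel lam c t +
      ∫ s in (0 : ℝ)..t, powerSource lam c G s * renewalKernel lam c (t - s) := by
  have hc := h.continuous_source
  have h1 : ∀ s, powerSource lam c G s * renewalKernel lam c (t - s) =
      ∑ k, c * lam k ^ 2 * (powerSource lam c G s * Real.exp (-2 * lam k * (t - s))) := by
    intro s
    rw [renewalKernel, Finset.mul_sum, Finset.mul_sum]
    exact Finset.sum_congr rfl fun k _ => by ring
  simp only [h1]
  rw [intervalIntegral.integral_finsetSum fun k _ =>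
    Continuous.intervalIntegrable (by fun_prop) _ _]
  simp only [intervalIntegral.integral_const_mul]
  rw [renewalKernel, powerSource, Finset.mul_sum, Finset.mul_sum, ← Finset.sum_add_distrib]
  refine Finset.sum_congr rfl fun k _ => ?_
  rw [h.mode_eq k t]
  ring

variable {r : ℝ}

/-- A Lyapunov functional for the tilted system: the weights `λ_k² / (2 λ_k - r)` sum to the total
mass of the tilted kernel. -/
lemma lyapunov_eq (h : PowerEvolution lam c G) (hgap : ∀ k, lam k ≠ 0 → r < 2 * lam k) (t : ℝ) :
    Real.exp (r * t) * (c * ∑ k, lam k ^ 2 / (2 * lam k - r) * G k t) +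
      (1 - c * ∑ k, lam k ^ 2 / (2 * lam k - r)) *
        ∫ s in (0 : ℝ)..t, powerSource lam c G s * Real.exp (r * s) =
      c * ∑ k, lam k ^ 2 / (2 * lam k - r) := by
  set v : κ → ℝ := fun k => lam k ^ 2 / (2 * lam k - r) with hv
  have hvl : ∀ k, v k * (2 * lam k - r) = lam k ^ 2 := by
    intro k
    by_cases hk : lam k = 0
    · simp [hv, hk]
    · have := hgap k hk
      exact div_mul_cancel₀ _ (by linarith)
  have hd : ∀ s, HasDerivAt (fun s => Real.exp (r * s) * (c * ∑ k, v k * G k s))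
      (-(1 - c * ∑ k, v k) * (powerSource lam c G s * Real.exp (r * s))) s := by
    intro s
    have h1 : HasDerivAt (fun s => r * s) r s := by simpa using (hasDerivAt_id s).const_mul r
    have h2 : HasDerivAt (fun s => c * ∑ k, v k * G k s)
        (c * ∑ k, v k * (-2 * lam k * G k s + powerSource lam c G s)) s :=
      (HasDerivAt.fun_sum fun k _ => (h.hasDerivAt k s).const_mul (v k)).const_mul c
    have h3 : c * ∑ k, v k * (-2 * lam k * G k s + powerSource lam c G s) =
        -(r * (c * ∑ k, v k * G k s)) - (1 - c * ∑ k, v k) * powerSource lam c G s := by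
      have h4 : ∀ k, v k * (-2 * lam k * G k s + powerSource lam c G s) =
          -(r * (v k * G k s)) - lam k ^ 2 * G k s + v k * powerSource lam c G s := by
        intro k; rw [← hvl k]; ring
      simp only [h4, Finset.sum_add_distrib, Finset.sum_sub_distrib, Finset.sum_neg_distrib,
        ← Finset.mul_sum, ← Finset.sum_mul]
      simp only [powerSource]
      ring
    rw [h3] at h2
    refine (h1.exp.mul h2).congr_deriv ?_
    ring
  have hc := h.continuous_source
  have := intervalIntegral.integral_eq_sub_of_hasDerivAt (fun s (_ : s ∈ Set.uIcc 0 t) => hd s)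
    (Continuous.intervalIntegrable (by fun_prop) _ _)
  rw [intervalIntegral.integral_const_mul] at this
  simp only [h.init, mul_zero, Real.exp_zero, mul_one, one_mul] at this
  linarith

lemma half_le_lyapunov_weight (h : PowerEvolution lam c G) (hr : 0 ≤ r)
    (hgap : ∀ k, lam k ≠ 0 → r < 2 * lam k) (k : κ) :
    lam k / 2 ≤ lam k ^ 2 / (2 * lam k - r) := by
  by_cases hk : lam k = 0
  · simp [hk]
  · have h1 := hgap k hk
    have h2 := h.lam_nonneg k
    rw [le_div_iff₀ (by linarith)]
    nlinarith

lemma lyapunov_weight_nonneg (h : PowerEvolution lam c G) (hr : 0 ≤ r)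
    (hgap : ∀ k, lam k ≠ 0 → r < 2 * lam k) (k : κ) : 0 ≤ lam k ^ 2 / (2 * lam k - r) :=
  (div_nonneg (h.lam_nonneg k) zero_le_two).trans (h.half_le_lyapunov_weight hr hgap k)

lemma integral_source_le (h : PowerEvolution lam c G) (hr : 0 ≤ r)
    (hgap : ∀ k, lam k ≠ 0 → r < 2 * lam k)
    (hm : c * ∑ k, lam k ^ 2 / (2 * lam k - r) ≤ 3 / 4) {t : ℝ} (ht : 0 ≤ t) :
    ∫ s in (0 : ℝ)..t, powerSource lam c G s * Real.exp (r * s) ≤ 3 := by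
  have h1 := h.lyapunov_eq hgap t
  have h2 : 0 ≤ ∫ s in (0 : ℝ)..t, powerSource lam c G s * Real.exp (r * s) :=
    intervalIntegral.integral_nonneg ht fun s hs =>
      mul_nonneg (h.source_nonneg hs.1) (Real.exp_pos _).le
  have h3 : 0 ≤ Real.exp (r * t) * (c * ∑ k, lam k ^ 2 / (2 * lam k - r) * G k t) :=
    mul_nonneg (Real.exp_pos _).le (mul_nonneg h.weight_nonneg (Finset.sum_nonneg fun k _ =>
      mul_nonneg (h.lyapunov_weight_nonneg hr hgap k) (h.nonneg k t ht)))
  nlinarith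

lemma integral_kernel_le (h : PowerEvolution lam c G) (hr : 0 ≤ r)
    (hgap : ∀ k, lam k ≠ 0 → r < 2 * lam k)
    (hm : c * ∑ k, lam k ^ 2 / (2 * lam k - r) ≤ 3 / 4) (t : ℝ) :
    ∫ s in (0 : ℝ)..t, renewalKernel lam c s * Real.exp (r * s) ≤ 3 / 4 := by
  have hd : ∀ s, HasDerivAt (fun s => -(c * ∑ k, lam k ^ 2 / (2 * lam k - r) *
      Real.exp (-(2 * lam k - r) * s))) (renewalKernel lam c s * Real.exp (r * s)) s := by
    intro s
    have h1 : ∀ k, HasDerivAt (fun s => lam k ^ 2 / (2 * lam k - r) *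
        Real.exp (-(2 * lam k - r) * s))
        (-(lam k ^ 2 * (Real.exp (-2 * lam k * s) * Real.exp (r * s)))) s := by
      intro k
      have h2 : HasDerivAt (fun s => -(2 * lam k - r) * s) (-(2 * lam k - r)) s := by
        simpa using (hasDerivAt_id s).const_mul (-(2 * lam k - r))
      refine (h2.exp.const_mul (lam k ^ 2 / (2 * lam k - r))).congr_deriv ?_
      rw [← Real.exp_add]
      by_cases hk : lam k = 0
      · simp [hk]
      · have := hgap k hk
        have h3 : 2 * lam k - r ≠ 0 := by linarith
        rw [show -2 * lam k * s + r * s = -(2 * lam k - r) * s by ring]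
        field_simp
        rw [div_self (by rwa [mul_comm])]
    refine ((HasDerivAt.fun_sum fun k (_ : k ∈ Finset.univ) => h1 k).const_mul c).neg.congr_deriv ?_
    rw [renewalKernel, Finset.sum_neg_distrib, mul_neg, neg_neg, mul_assoc, Finset.sum_mul]
    congr 1
    exact Finset.sum_congr rfl fun k _ => by ring
  have hc := continuous_kernel lam c
  rw [intervalIntegral.integral_eq_sub_of_hasDerivAt (fun s _ => hd s)
    (Continuous.intervalIntegrable (by fun_prop) _ _)]
  simp only [mul_zero, Real.exp_zero, mul_one]
  have : 0 ≤ c * ∑ k, lam k ^ 2 / (2 * lam k - r) * Real.exp (-(2 * lam k - r) * t) :=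
    mul_nonneg h.weight_nonneg (Finset.sum_nonneg fun k _ =>
      mul_nonneg (h.lyapunov_weight_nonneg hr hgap k) (Real.exp_pos _).le)
  linarith

end PowerEvolution

end Renewal

/-! ### Decay of solutions of the renewal equation -/

section Decay

/-- The profile `(1 + t)^(-p) + ε` of a heat kernel on a finite torus: a power law which levels off
at `ε` once the walk has mixed. -/
noncomputable def decayProfile (p ε t : ℝ) : ℝ := (1 + t) ^ (-p) + ε

lemma decayProfile_pos {p ε t : ℝ} (hε : 0 ≤ ε) (ht : 0 ≤ t) : 0 < decayProfile p ε t :=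
  add_pos_of_pos_of_nonneg (Real.rpow_pos_of_pos (by linarith) _) hε

lemma continuousOn_decayProfile (p ε : ℝ) : ContinuousOn (decayProfile p ε) (Set.Ici 0) := by
  refine ContinuousOn.add (ContinuousOn.rpow_const (by fun_prop) fun t ht => Or.inl ?_)
    continuousOn_const
  have : (0 : ℝ) ≤ t := ht
  linarith

lemma decayProfile_le {p ε θ s t : ℝ} (hp : 0 ≤ p) (hε : 0 ≤ ε) (hθ : 0 < θ) (hθ1 : θ ≤ 1)
    (ht : 0 ≤ t) (hs : θ * t ≤ s) : decayProfile p ε s ≤ θ ^ (-p) * decayProfile p ε t := by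
  have h1 : (1 + s) ^ (-p) ≤ θ ^ (-p) * (1 + t) ^ (-p) := by
    rw [← Real.mul_rpow hθ.le (by linarith)]
    exact Real.rpow_le_rpow_of_nonpos (by positivity) (by nlinarith) (by linarith)
  have h2 : 1 ≤ θ ^ (-p) := Real.one_le_rpow_of_pos_of_le_one_of_nonpos hθ hθ1 (by linarith)
  unfold decayProfile
  nlinarith

/-- The constant in the bound for solutions of a defective renewal equation. The point `θ` at which
the convolution is split satisfies `θ^(-p) * (3 / 4) = 7 / 8 < 1`. -/
noncomputable def renewalConst (A p : ℝ) : ℝ :=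
  8 * (A + 3 * (A * (1 - (6 / 7 : ℝ) ^ p⁻¹) ^ (-p)))

namespace PowerEvolution

variable {κ : Type*} [Fintype κ] {lam : κ → ℝ} {c : ℝ} {G : κ → ℝ → ℝ} {r : ℝ}

/-- The source inherits the decay of the kernel: as the tilted kernel has mass at most `3 / 4`, and
power laws are insensitive to a change of time scale, the convolution in the renewal equation can be
absorbed, after splitting it at `θ t`. -/
theorem source_le (h : PowerEvolution lam c G) (hr : 0 ≤ r)
    (hgap : ∀ k, lam k ≠ 0 → r < 2 * lam k)
    (hm : c * ∑ k, lam k ^ 2 / (2 * lam k - r) ≤ 3 / 4) {p ε A : ℝ} (hp : 0 < p) (hε : 0 ≤ ε)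
    (hA : ∀ t, 0 ≤ t → renewalKernel lam c t * Real.exp (r * t) ≤ A * decayProfile p ε t)
    {T : ℝ} (hT : 0 ≤ T) :
    powerSource lam c G T * Real.exp (r * T) ≤ renewalConst A p * decayProfile p ε T := by
  set w := decayProfile p ε with hw
  set Φ : ℝ → ℝ := fun s => powerSource lam c G s * Real.exp (r * s) with hΦ
  set α : ℝ → ℝ := fun s => renewalKernel lam c s * Real.exp (r * s) with hα
  have hcs := h.continuous_source
  have hck := continuous_kernel lam c
  have hΦc : Continuous Φ := by fun_prop
  have hαc : Continuous α := by fun_prop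
  have hΦ0 : ∀ s, 0 ≤ s → 0 ≤ Φ s := fun s hs =>
    mul_nonneg (h.source_nonneg hs) (Real.exp_pos _).le
  have hα0 : ∀ s, 0 ≤ α s := fun s => mul_nonneg (h.kernel_nonneg s) (Real.exp_pos _).le
  have hw0 : ∀ s, 0 ≤ s → 0 < w s := fun s hs => decayProfile_pos hε hs
  have hA0 : 0 ≤ A := by
    have := (hα0 0).trans (hA 0 le_rfl)
    exact nonneg_of_mul_nonneg_left this (hw0 0 le_rfl)
  set θ : ℝ := (6 / 7 : ℝ) ^ p⁻¹ with hθ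
  have hθ0 : 0 < θ := Real.rpow_pos_of_pos (by norm_num) _
  have hθ1 : θ < 1 := Real.rpow_lt_one (by norm_num) (by norm_num) (inv_pos.2 hp)
  have hθp : θ ^ (-p) = 7 / 6 := by
    rw [Real.rpow_neg hθ0.le, hθ, ← Real.rpow_mul (by norm_num), inv_mul_cancel₀ hp.ne',
      Real.rpow_one]
    norm_num
  -- the maximum of the ratio to be bounded
  obtain ⟨τ, hτ, hmax⟩ := (isCompact_Icc (a := (0 : ℝ)) (b := T)).exists_isMaxOn
    ⟨0, le_rfl, hT⟩ (f := fun s => Φ s / w s)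
    (hΦc.continuousOn.div ((continuousOn_decayProfile p ε).mono fun s hs => hs.1)
      fun s hs => (hw0 s hs.1).ne')
  set M := Φ τ / w τ with hM
  have hM0 : 0 ≤ M := div_nonneg (hΦ0 τ hτ.1) (hw0 τ hτ.1).le
  have hΦM : ∀ s ∈ Set.Icc 0 T, Φ s ≤ M * w s := fun s hs =>
    (div_le_iff₀ (hw0 s hs.1)).1 (hmax hs)
  have hren : Φ τ = α τ + ∫ s in (0 : ℝ)..τ, Φ s * α (τ - s) := by
    have h1 : ∀ s, Φ s * α (τ - s) = Real.exp (r * τ) *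
        (powerSource lam c G s * renewalKernel lam c (τ - s)) := by
      intro s
      simp only [hΦ, hα]
      rw [show r * τ = r * s + r * (τ - s) by ring, Real.exp_add]
      ring
    simp only [h1, intervalIntegral.integral_const_mul]
    simp only [hΦ, hα]
    rw [h.source_eq τ]
    ring
  have hθτ : θ * τ ≤ τ := mul_le_of_le_one_left hτ.1 hθ1.le
  have hθτ0 : 0 ≤ θ * τ := mul_nonneg hθ0.le hτ.1
  have hint : ∀ a b, IntervalIntegrable (fun s => Φ s * α (τ - s)) volume a b := fun a b =>
    Continuous.intervalIntegrable (by fun_prop) _ _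
  have hfirst : ∫ s in (0 : ℝ)..(θ * τ), Φ s * α (τ - s) ≤
      3 * (A * (1 - θ) ^ (-p)) * w τ := by
    have hB : 0 ≤ A * (1 - θ) ^ (-p) * w τ :=
      mul_nonneg (mul_nonneg hA0 (Real.rpow_nonneg (by linarith) _)) (hw0 τ hτ.1).le
    calc ∫ s in (0 : ℝ)..(θ * τ), Φ s * α (τ - s)
        ≤ ∫ s in (0 : ℝ)..(θ * τ), Φ s * (A * (1 - θ) ^ (-p) * w τ) := by
          refine intervalIntegral.integral_mono_on hθτ0 (hint _ _)
            (Continuous.intervalIntegrable (by fun_prop) _ _) fun s hs => ?_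
          refine mul_le_mul_of_nonneg_left ?_ (hΦ0 s hs.1)
          have hs' : s ≤ τ := hs.2.trans hθτ
          refine (hA (τ - s) (by linarith)).trans ?_
          rw [mul_assoc]
          exact mul_le_mul_of_nonneg_left (decayProfile_le hp.le hε (by linarith) (by linarith)
            hτ.1 (by linarith [hs.2])) hA0
      _ ≤ 3 * (A * (1 - θ) ^ (-p) * w τ) := by
          rw [intervalIntegral.integral_mul_const]
          exact mul_le_mul_of_nonneg_right (h.integral_source_le hr hgap hm hθτ0) hB
      _ = _ := by ring
  have hsecond : ∫ s in (θ * τ)..τ, Φ s * α (τ - s) ≤ 7 / 8 * (M * w τ) := by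
    have hB : 0 ≤ M * w τ := mul_nonneg hM0 (hw0 τ hτ.1).le
    calc ∫ s in (θ * τ)..τ, Φ s * α (τ - s)
        ≤ ∫ s in (θ * τ)..τ, 7 / 6 * (M * w τ) * α (τ - s) := by
          refine intervalIntegral.integral_mono_on hθτ (hint _ _)
            (Continuous.intervalIntegrable (by fun_prop) _ _) fun s hs => ?_
          refine mul_le_mul_of_nonneg_right ?_ (hα0 _)
          refine (hΦM s ⟨hθτ0.trans hs.1, hs.2.trans hτ.2⟩).trans ?_
          have := decayProfile_le (p := p) hp.le hε hθ0 hθ1.le hτ.1 hs.1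
          rw [hθp] at this
          calc M * w s ≤ M * (7 / 6 * w τ) := mul_le_mul_of_nonneg_left this hM0
            _ = _ := by ring
      _ = 7 / 6 * (M * w τ) * ∫ s in (0 : ℝ)..(τ - θ * τ), α s := by
          rw [intervalIntegral.integral_const_mul,
            intervalIntegral.integral_comp_sub_left (fun s => α s) τ, sub_self]
      _ ≤ 7 / 6 * (M * w τ) * (3 / 4) :=
          mul_le_mul_of_nonneg_left (h.integral_kernel_le hr hgap hm _) (by positivity)
      _ = _ := by ring
  have hsplit := intervalIntegral.integral_add_adjacent_intervals (hint 0 (θ * τ)) (hint (θ * τ) τ)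
  have hMτ : M * w τ = Φ τ := div_mul_cancel₀ _ (hw0 τ hτ.1).ne'
  have hMB : M ≤ renewalConst A p := by
    have h1 : M * w τ ≤ renewalConst A p * w τ := by
      have h2 := hA τ hτ.1
      have h3 : renewalConst A p = 8 * (A + 3 * (A * (1 - θ) ^ (-p))) := rfl
      rw [h3]
      change α τ ≤ A * w τ at h2
      nlinarith
    exact le_of_mul_le_mul_right h1 (hw0 τ hτ.1)
  exact (hΦM T ⟨hT, le_rfl⟩).trans (mul_le_mul_of_nonneg_right hMB (hw0 T hT).le)

end PowerEvolution

/-- A function which tends to `0` is bounded by `B (p⁻¹ + C) ((1 + t)^(-p) + ε') exp (-r t)` if its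
rate of decrease is at most `B ((1 + t)^(-(p + 1)) + ε) exp (-r t)`. -/
lemma le_decayProfile_of_deriv {u u' : ℝ → ℝ} {B C p r ε ε' : ℝ} (hB : 0 ≤ B) (hC : 0 ≤ C)
    (hp : 0 < p) (hr : 0 < r) (hε' : 0 ≤ ε') (hεε' : ε ≤ C * (r * ε'))
    (hd : ∀ t, 0 ≤ t → HasDerivAt u (u' t) t)
    (hu' : ∀ t, 0 ≤ t → -u' t ≤ B * decayProfile (p + 1) ε t * Real.exp (-(r * t)))
    (hlim : Tendsto u atTop (𝓝 0)) {t : ℝ} (ht : 0 ≤ t) :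
    u t ≤ B * (p⁻¹ + C) * decayProfile p ε' t * Real.exp (-(r * t)) := by
  set B' := B * (p⁻¹ + C) with hB'
  have hB'0 : 0 ≤ B' := by positivity
  set H : ℝ → ℝ := fun t => B' * decayProfile p ε' t * Real.exp (-(r * t)) with hH
  have hHd : ∀ t, 0 ≤ t → HasDerivAt H (B' * (-p * (1 + t) ^ (-(p + 1))) * Real.exp (-(r * t)) +
      B' * decayProfile p ε' t * (Real.exp (-(r * t)) * -r)) t := by
    intro t ht
    have h1 : HasDerivAt (decayProfile p ε') (-p * (1 + t) ^ (-(p + 1))) t := by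
      have h2 : HasDerivAt (fun t : ℝ => 1 + t) 1 t := (hasDerivAt_id t).const_add 1
      refine ((h2.rpow_const (p := -p) (Or.inl (by linarith))).add_const ε').congr_deriv ?_
      rw [one_mul, show -p - 1 = -(p + 1) by ring]
    have h3 : HasDerivAt (fun t : ℝ => Real.exp (-(r * t))) (Real.exp (-(r * t)) * -r) t := by
      exact (((hasDerivAt_id t).const_mul r).neg.congr_deriv (by simp)).exp
    exact (h1.const_mul B').mul h3
  have hHlim : Tendsto H atTop (𝓝 0) := by
    have h1 : Tendsto (fun t : ℝ => (1 + t) ^ (-p)) atTop (𝓝 0) :=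
      (tendsto_rpow_neg_atTop hp).comp (tendsto_atTop_add_const_left _ 1 tendsto_id)
    have h2 : Tendsto (fun t : ℝ => Real.exp (-(r * t))) atTop (𝓝 0) :=
      Real.tendsto_exp_neg_atTop_nhds_zero.comp (tendsto_id.const_mul_atTop hr)
    have := ((h1.add_const ε').const_mul B').mul h2
    rwa [mul_zero] at this
  have hanti : AntitoneOn (fun t => H t - u t) (Set.Ici 0) := by
    have hd' : ∀ t, 0 ≤ t → HasDerivAt (fun t => H t - u t) _ t := fun t ht =>
      (hHd t ht).sub (hd t ht)
    refine antitoneOn_of_deriv_nonpos (convex_Ici 0)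
      (fun t ht => (hd' t ht).continuousAt.continuousWithinAt)
      (fun t ht => (hd' t (interior_subset ht)).differentiableAt.differentiableWithinAt)
      fun t ht => ?_
    have ht0 : 0 ≤ t := interior_subset ht
    rw [(hd' t ht0).deriv]
    have h1 := hu' t ht0
    have h2 : 0 < (1 + t) ^ (-(p + 1)) := Real.rpow_pos_of_pos (by linarith) _
    have h2' : 0 < (1 + t) ^ (-p) := Real.rpow_pos_of_pos (by linarith) _
    have h3 : B * decayProfile (p + 1) ε t ≤
        B' * (p * (1 + t) ^ (-(p + 1))) + B' * decayProfile p ε' t * r := by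
      have h4 : B' * p = B + B * C * p := by rw [hB']; field_simp
      have h5 : B * ε ≤ B' * (r * ε') := by
        calc B * ε ≤ B * (C * (r * ε')) := mul_le_mul_of_nonneg_left hεε' hB
          _ ≤ B' * (r * ε') := by
            rw [← mul_assoc, hB']
            refine mul_le_mul_of_nonneg_right (mul_le_mul_of_nonneg_left ?_ hB) (by positivity)
            have := inv_pos.2 hp
            linarith
      unfold decayProfile
      have h6 : 0 ≤ B' * r * (1 + t) ^ (-p) := by positivity
      have h7 : 0 ≤ B * C * p * (1 + t) ^ (-(p + 1)) := by positivity
      calc B * ((1 + t) ^ (-(p + 1)) + ε) = B * (1 + t) ^ (-(p + 1)) + B * ε := by ring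
        _ ≤ (B + B * C * p) * (1 + t) ^ (-(p + 1)) + B' * (r * ε') + B' * r * (1 + t) ^ (-p) := by
          linarith
        _ = _ := by rw [← h4]; ring
    have h8 := mul_le_mul_of_nonneg_right h3 (Real.exp_pos (-(r * t))).le
    linarith
  have hlim' : Tendsto (fun t => H t - u t) atTop (𝓝 0) := by simpa using hHlim.sub hlim
  have : 0 ≤ H t - u t := by
    refine le_of_tendsto hlim' ?_
    filter_upwards [eventually_ge_atTop t] with s hs
    exact hanti ht (ht.trans hs) hs
  linarith

namespace PowerEvolution

variable {κ : Type*} [Fintype κ] {lam : κ → ℝ} {c : ℝ} {G : κ → ℝ → ℝ} {r : ℝ}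

lemma energy_le_exp (h : PowerEvolution lam c G) (hr : 0 ≤ r)
    (hgap : ∀ k, lam k ≠ 0 → r < 2 * lam k)
    (hm : c * ∑ k, lam k ^ 2 / (2 * lam k - r) ≤ 3 / 4) {t : ℝ} (ht : 0 ≤ t) :
    c * ∑ k, lam k * G k t ≤ 2 * Real.exp (-(r * t)) := by
  have h1 := h.lyapunov_eq hgap t
  have h2 : 0 ≤ ∫ s in (0 : ℝ)..t, powerSource lam c G s * Real.exp (r * s) :=
    intervalIntegral.integral_nonneg ht fun s hs =>
      mul_nonneg (h.source_nonneg hs.1) (Real.exp_pos _).le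
  have h3 : c * ∑ k, lam k * G k t ≤ 2 * (c * ∑ k, lam k ^ 2 / (2 * lam k - r) * G k t) := by
    rw [mul_left_comm]
    refine mul_le_mul_of_nonneg_left ?_ h.weight_nonneg
    rw [Finset.mul_sum]
    refine Finset.sum_le_sum fun k _ => ?_
    rw [← mul_assoc]
    refine mul_le_mul_of_nonneg_right ?_ (h.nonneg k t ht)
    linarith [h.half_le_lyapunov_weight hr hgap k]
  have h4 : Real.exp (r * t) * (c * ∑ k, lam k ^ 2 / (2 * lam k - r) * G k t) ≤ 1 := by nlinarith
  have h5 : c * ∑ k, lam k ^ 2 / (2 * lam k - r) * G k t ≤ Real.exp (-(r * t)) := by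
    rw [Real.exp_neg, ← one_div, le_div_iff₀ (Real.exp_pos _), mul_comm]
    exact h4
  linarith

lemma tendsto_energy (h : PowerEvolution lam c G) (hr : 0 < r)
    (hgap : ∀ k, lam k ≠ 0 → r < 2 * lam k)
    (hm : c * ∑ k, lam k ^ 2 / (2 * lam k - r) ≤ 3 / 4) :
    Tendsto (fun t => c * ∑ k, lam k * G k t) atTop (𝓝 0) := by
  have h2 : Tendsto (fun t : ℝ => 2 * Real.exp (-(r * t))) atTop (𝓝 0) := by
    simpa using (Real.tendsto_exp_neg_atTop_nhds_zero.comp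
      (tendsto_id.const_mul_atTop hr)).const_mul 2
  refine squeeze_zero' ?_ ?_ h2
  · filter_upwards [eventually_ge_atTop 0] with t ht
    exact mul_nonneg h.weight_nonneg (Finset.sum_nonneg fun k _ =>
      mul_nonneg (h.lam_nonneg k) (h.nonneg k t ht))
  · filter_upwards [eventually_ge_atTop 0] with t ht
    exact h.energy_le_exp hr.le hgap hm ht

/-- The energy decreases at the rate given by the source. -/
lemma hasDerivAt_energy (h : PowerEvolution lam c G) (t : ℝ) :
    HasDerivAt (fun t => c * ∑ k, lam k * G k t) (-powerSource lam c G t) t := by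
  refine ((HasDerivAt.fun_sum fun k (_ : k ∈ Finset.univ) =>
    (h.hasDerivAt k t).const_mul (lam k)).const_mul c).congr_deriv ?_
  have h4 : ∀ k, lam k * (-2 * lam k * G k t + powerSource lam c G t) =
      -2 * (lam k ^ 2 * G k t) + lam k * powerSource lam c G t := fun k => by ring
  simp only [h4, Finset.sum_add_distrib, ← Finset.mul_sum, ← Finset.sum_mul]
  rw [mul_add, ← mul_assoc c (∑ k, lam k), h.weight_sum, powerSource]
  ring

theorem energy_le (h : PowerEvolution lam c G) (hr : 0 < r)
    (hgap : ∀ k, lam k ≠ 0 → r < 2 * lam k)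
    (hm : c * ∑ k, lam k ^ 2 / (2 * lam k - r) ≤ 3 / 4) {p ε ε' A C : ℝ} (hp : 0 < p)
    (hε : 0 ≤ ε) (hε' : 0 ≤ ε') (hC : 0 ≤ C) (hεε' : ε ≤ C * (r * ε'))
    (hB : 0 ≤ renewalConst A (p + 1))
    (hA : ∀ t, 0 ≤ t → renewalKernel lam c t * Real.exp (r * t) ≤ A * decayProfile (p + 1) ε t)
    {t : ℝ} (ht : 0 ≤ t) :
    c * ∑ k, lam k * G k t ≤
      renewalConst A (p + 1) * (p⁻¹ + C) * decayProfile p ε' t * Real.exp (-(r * t)) := by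
  refine le_decayProfile_of_deriv hB hC hp hr hε' hεε' (fun s _ => h.hasDerivAt_energy s)
    (fun s hs => ?_) (h.tendsto_energy hr hgap hm) ht
  rw [neg_neg, Real.exp_neg, ← div_eq_mul_inv, le_div_iff₀ (Real.exp_pos _)]
  exact h.source_le hr.le hgap hm (by linarith) hε hA hs

/-- A bound for the energy integrates to a bound for the sum of the decaying modes. -/
theorem variance_le (h : PowerEvolution lam c G) (hr : 0 < r)
    (hgap : ∀ k, lam k ≠ 0 → r < 2 * lam k)
    (hm : c * ∑ k, lam k ^ 2 / (2 * lam k - r) ≤ 3 / 4) (S : Finset κ)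
    (hS : ∀ k, k ∈ S ↔ lam k ≠ 0) {p ε ε' B C : ℝ} (hp : 0 < p)
    (hε' : 0 ≤ ε') (hC : 0 ≤ C) (hεε' : ε ≤ C * (r * ε')) (hB : 0 ≤ B)
    (henergy : ∀ t, 0 ≤ t → c * ∑ k, lam k * G k t ≤
      B * decayProfile (p + 1) ε t * Real.exp (-(r * t))) {t : ℝ} (ht : 0 ≤ t) :
    c * ∑ k ∈ S, G k t ≤ 2 * B * (p⁻¹ + C) * decayProfile p ε' t * Real.exp (-(r * t)) := by
  have henergy0 : ∀ t, 0 ≤ t → 0 ≤ c * ∑ k, lam k * G k t := fun t ht =>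
    mul_nonneg h.weight_nonneg (Finset.sum_nonneg fun k _ =>
      mul_nonneg (h.lam_nonneg k) (h.nonneg k t ht))
  have hsumS : ∀ t, ∑ k ∈ S, lam k * G k t = ∑ k, lam k * G k t := fun t =>
    Finset.sum_subset (Finset.subset_univ S) fun k _ hk => by
      rw [hS, not_not] at hk
      simp [hk]
  have hvar0 : ∀ t, 0 ≤ t → 0 ≤ c * ∑ k ∈ S, G k t := fun t ht =>
    mul_nonneg h.weight_nonneg (Finset.sum_nonneg fun k _ => h.nonneg k t ht)
  have hvar : ∀ t, 0 ≤ t → c * ∑ k ∈ S, G k t ≤ 2 / r * (c * ∑ k, lam k * G k t) := by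
    intro t ht
    rw [mul_left_comm, ← hsumS]
    refine mul_le_mul_of_nonneg_left ?_ h.weight_nonneg
    rw [Finset.mul_sum]
    refine Finset.sum_le_sum fun k hk => ?_
    have h1 := hgap k ((hS k).1 hk)
    rw [← mul_assoc]
    refine le_mul_of_one_le_left (h.nonneg k t ht) ?_
    rw [div_mul_eq_mul_div, le_div_iff₀ hr]
    linarith
  -- the derivative of this combination contains no source term
  set u : ℝ → ℝ := fun t => c * ∑ k ∈ S, G k t + c * S.card * (c * ∑ k, lam k * G k t) with hu
  have hd : ∀ t, HasDerivAt u (-2 * (c * ∑ k, lam k * G k t)) t := by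
    intro t
    refine (((HasDerivAt.fun_sum fun k (_ : k ∈ S) => h.hasDerivAt k t).const_mul c).add
      ((h.hasDerivAt_energy t).const_mul (c * S.card))).congr_deriv ?_
    rw [Finset.sum_add_distrib, ← hsumS]
    simp only [mul_assoc, ← Finset.mul_sum, Finset.sum_const, nsmul_eq_mul]
    ring
  have hlim : Tendsto u atTop (𝓝 0) := by
    have h1 := h.tendsto_energy hr hgap hm
    have h2 : Tendsto (fun t => c * ∑ k ∈ S, G k t) atTop (𝓝 0) := by
      refine squeeze_zero' ?_ ?_ (by simpa using h1.const_mul (2 / r))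
      · filter_upwards [eventually_ge_atTop 0] with t ht using hvar0 t ht
      · filter_upwards [eventually_ge_atTop 0] with t ht using hvar t ht
    simpa using h2.add (h1.const_mul (c * S.card))
  have h3 := le_decayProfile_of_deriv (B := 2 * B) (by positivity) hC hp hr hε' hεε'
    (fun s _ => hd s) (fun s hs => by nlinarith [henergy s hs]) hlim ht
  refine le_trans ?_ h3
  have := henergy0 t ht
  have := h.weight_nonneg
  exact le_add_of_nonneg_right (by positivity)

end PowerEvolution

end Decay

/-! ### The spectrum of simple random walk on the torus -/

section Spectrum

lemma one_sub_cos_two_pi_mul_ge {a : ℝ} (h0 : 0 ≤ a) (h1 : a ≤ 1 / 2) :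
    8 * a ^ 2 ≤ 1 - Real.cos (2 * Real.pi * a) := by
  have h2 := Real.mul_le_sin (x := Real.pi * a) (by positivity) (by nlinarith [Real.pi_pos])
  rw [← mul_assoc, div_mul_cancel₀ _ Real.pi_pos.ne'] at h2
  rw [mul_assoc, Real.cos_two_mul, Real.cos_sq']
  nlinarith

lemma one_sub_cos_two_pi_mul_le (a : ℝ) : 1 - Real.cos (2 * Real.pi * a) ≤ 20 * a ^ 2 := by
  have h1 := Real.one_sub_sq_div_two_le_cos (x := 2 * Real.pi * a)
  have h2 : Real.pi ^ 2 ≤ 10 := by nlinarith [Real.pi_lt_d2, Real.pi_pos]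
  nlinarith [sq_nonneg a]

lemma cos_two_pi_sub_div {n : ℝ} (hn : n ≠ 0) (j : ℝ) :
    Real.cos (2 * Real.pi * (n - j) / n) = Real.cos (2 * Real.pi * j / n) := by
  rw [← Real.cos_two_pi_sub (2 * Real.pi * j / n)]
  congr 1
  field_simp

lemma cycleGap_ge {n : ℕ} (hn : 2 ≤ n) : 8 / (n : ℝ) ^ 2 ≤ cycleGap n := by
  have hn' : (2 : ℝ) ≤ n := by exact_mod_cast hn
  have h := one_sub_cos_two_pi_mul_ge (a := 1 / n) (by positivity)
    (one_div_le_one_div_of_le (by norm_num) hn')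
  rw [cycleGap, div_eq_mul_one_div (2 * Real.pi)]
  refine le_trans (le_of_eq ?_) h
  rw [one_div, inv_pow, div_eq_mul_inv]

lemma cycleGap_le (n : ℕ) : cycleGap n ≤ 20 / (n : ℝ) ^ 2 := by
  have h := one_sub_cos_two_pi_mul_le (1 / n)
  rw [cycleGap, div_eq_mul_one_div (2 * Real.pi)]
  refine h.trans (le_of_eq ?_)
  rw [one_div, inv_pow, div_eq_mul_inv]

/-- The frequencies other than `0` and `±1` have at least twice the spectral gap of the cycle. -/
lemma two_mul_cycleGap_le {n j : ℕ} (hn : 4 ≤ n) (hj : 2 ≤ j) (hjn : j + 2 ≤ n) :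
    2 * cycleGap n ≤ 1 - Real.cos (2 * Real.pi * j / n) := by
  have hn' : (4 : ℝ) ≤ n := by exact_mod_cast hn
  have hn0 : (0 : ℝ) < n := by linarith
  have hpi := Real.pi_pos
  have key : ∀ x : ℝ, 2 ≤ x → 2 * x ≤ n → 2 * cycleGap n ≤ 1 - Real.cos (2 * Real.pi * x / n) := by
    intro x hx hxn
    have h1 : Real.cos (2 * Real.pi * x / n) ≤ Real.cos (2 * (2 * Real.pi / n)) := by
      refine Real.cos_le_cos_of_nonneg_of_le_pi (by positivity) ?_ ?_
      · rw [div_le_iff₀ hn0]; nlinarith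
      · rw [← mul_div_assoc]
        refine div_le_div_of_nonneg_right ?_ hn0.le
        nlinarith
    have h2 : 0 ≤ Real.cos (2 * Real.pi / n) := by
      refine Real.cos_nonneg_of_neg_pi_div_two_le_of_le ?_ ?_
      · have : 0 ≤ 2 * Real.pi / n := by positivity
        linarith
      · rw [div_le_iff₀ hn0]; nlinarith
    rw [Real.cos_two_mul] at h1
    have h3 := Real.cos_le_one (2 * Real.pi / n)
    unfold cycleGap
    nlinarith
  have hj' : (2 : ℝ) ≤ j := by exact_mod_cast hj
  have hjn' : (j : ℝ) + 2 ≤ n := by exact_mod_cast hjn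
  rcases le_total (2 * (j : ℝ)) n with h | h
  · exact key j hj' h
  · rw [← cos_two_pi_sub_div hn0.ne']
    exact key (n - j) (by linarith) (by linarith)

variable {d n : ℕ} [NeZero n]

lemma one_sub_cos_val_of_eq_one {n : ℕ} (hn : 4 ≤ n) :
    1 - Real.cos (2 * Real.pi * (1 : ZMod n).val / n) = cycleGap n := by
  have : Fact (1 < n) := ⟨by omega⟩
  rw [ZMod.val_one]
  simp [cycleGap]

lemma one_sub_cos_val_of_eq_neg_one (hn : 4 ≤ n) :
    1 - Real.cos (2 * Real.pi * (-1 : ZMod n).val / n) = cycleGap n := by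
  have hn0 : (n : ℝ) ≠ 0 := Nat.cast_ne_zero.2 (by omega)
  have hval : (-1 : ZMod n).val = n - 1 := by
    obtain ⟨m, rfl⟩ : ∃ m, n = m + 1 := ⟨n - 1, by omega⟩
    simp [ZMod.val_neg_one]
  rw [hval, Nat.cast_sub (by omega), cos_two_pi_sub_div hn0]
  simp [cycleGap]

lemma one_sub_cos_val_cases (hn : 4 ≤ n) (a : ZMod n) :
    a = 0 ∨ a = 1 ∨ a = -1 ∨
      2 * cycleGap n ≤ 1 - Real.cos (2 * Real.pi * a.val / n) := by
  have hlt := ZMod.val_lt a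
  have ha : ((a.val : ℕ) : ZMod n) = a := ZMod.natCast_zmod_val a
  by_cases h0 : a.val = 0
  · left; rw [← ha, h0, Nat.cast_zero]
  by_cases h1 : a.val = 1
  · right; left; rw [← ha, h1, Nat.cast_one]
  by_cases h2 : a.val = n - 1
  · right; right; left
    rw [← ha, h2, Nat.cast_sub (by omega), Nat.cast_one, ZMod.natCast_self, zero_sub]
  · right; right; right
    exact two_mul_cycleGap_le hn (by omega) (by omega)

lemma cycleGap_le_one_sub_cos_val (hn : 4 ≤ n) {a : ZMod n} (ha : a ≠ 0) :
    cycleGap n ≤ 1 - Real.cos (2 * Real.pi * a.val / n) := by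
  have hγ : 0 ≤ cycleGap n := sub_nonneg.2 (Real.cos_le_one _)
  rcases one_sub_cos_val_cases hn a with h | h | h | h
  · exact absurd h ha
  · rw [h, one_sub_cos_val_of_eq_one hn]
  · rw [h, one_sub_cos_val_of_eq_neg_one hn]
  · linarith

lemma torusEigenvalue_nonneg {d n : ℕ} (k : Torus d n) : 0 ≤ torusEigenvalue k :=
  mul_nonneg (by positivity) (Finset.sum_nonneg fun j _ => sub_nonneg.2 (Real.cos_le_one _))

lemma torusEigenvalue_le_two (k : Torus d n) : torusEigenvalue k ≤ 2 := by
  rcases Nat.eq_zero_or_pos d with rfl | hd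
  · simp [torusEigenvalue]
  have hd' : (0 : ℝ) < d := Nat.cast_pos.2 hd
  rw [torusEigenvalue, inv_mul_le_iff₀ hd']
  calc ∑ j, (1 - Real.cos (2 * Real.pi * (k j).val / n)) ≤ ∑ j : Fin d, (2 : ℝ) :=
        Finset.sum_le_sum fun j _ => by linarith [Real.neg_one_le_cos (2 * Real.pi * (k j).val / n)]
    _ = d * 2 := by simp

lemma torusEigenvalue_zero {d n : ℕ} : torusEigenvalue (0 : Torus d n) = 0 := by
  simp [torusEigenvalue]

lemma torusEigenvalue_single (j : Fin d) (a : ZMod n) :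
    torusEigenvalue (Pi.single j a : Torus d n) =
      (1 - Real.cos (2 * Real.pi * a.val / n)) / d := by
  rw [torusEigenvalue, Finset.sum_eq_single j]
  · rw [Pi.single_eq_same, inv_mul_eq_div]
  · intro i _ hi
    simp [hi]
  · simp

/-- The frequencies `±e_j`, at which `1 - P` has its smallest positive eigenvalue. -/
def IsLowestMode (k : Torus d n) : Prop := ∃ j : Fin d, k = Pi.single j 1 ∨ k = Pi.single j (-1)

lemma IsLowestMode.torusEigenvalue_eq (hn : 4 ≤ n) {k : Torus d n} (hk : IsLowestMode k) :
    torusEigenvalue k = cycleGap n / d := by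
  rcases hk with ⟨j, rfl | rfl⟩
  · rw [torusEigenvalue_single, one_sub_cos_val_of_eq_one hn]
  · rw [torusEigenvalue_single, one_sub_cos_val_of_eq_neg_one hn]

/-- Every mode other than the constant one and the lowest ones has at least twice the smallest
positive eigenvalue. -/
lemma two_mul_le_torusEigenvalue (hn : 4 ≤ n) {k : Torus d n} (hk0 : k ≠ 0)
    (hk : ¬IsLowestMode k) : 2 * cycleGap n / d ≤ torusEigenvalue k := by
  have hγ : 0 ≤ cycleGap n := sub_nonneg.2 (Real.cos_le_one _)
  rw [torusEigenvalue, ← inv_mul_eq_div]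
  refine mul_le_mul_of_nonneg_left ?_ (by positivity)
  have hpos : ∀ j, 0 ≤ 1 - Real.cos (2 * Real.pi * (k j).val / n) := fun j =>
    sub_nonneg.2 (Real.cos_le_one _)
  obtain ⟨i, hi⟩ := Function.ne_iff.1 hk0
  by_cases hother : ∃ j, j ≠ i ∧ k j ≠ 0
  · obtain ⟨j, hji, hj⟩ := hother
    have h1 := cycleGap_le_one_sub_cos_val hn hi
    have h2 := cycleGap_le_one_sub_cos_val hn hj
    have h3 := Finset.sum_le_sum_of_subset_of_nonneg
      (Finset.subset_univ ({j, i} : Finset (Fin d))) fun l _ _ => hpos l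
    rw [Finset.sum_pair hji] at h3
    linarith
  · push Not at hother
    have hks : k = Pi.single i (k i) := by
      funext j
      by_cases hj : j = i
      · subst hj; simp
      · rw [Pi.single_eq_of_ne hj, hother j hj]
    have h3 := Finset.single_le_sum (fun l _ => hpos l) (Finset.mem_univ i)
    rcases one_sub_cos_val_cases hn (k i) with h | h | h | h
    · exact absurd h hi
    · exact absurd ⟨i, Or.inl (by rw [← h]; exact hks)⟩ hk
    · exact absurd ⟨i, Or.inr (by rw [← h]; exact hks)⟩ hk
    · exact h.trans h3

lemma torusEigenvalue_ne_zero_iff (hd : 1 ≤ d) (hn : 4 ≤ n) (k : Torus d n) :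
    torusEigenvalue k ≠ 0 ↔ k ≠ 0 := by
  have hγ : 0 < cycleGap n := lt_of_lt_of_le (by positivity) (cycleGap_ge (by omega))
  have hd' : (0 : ℝ) < d := by exact_mod_cast hd
  refine ⟨fun h hk => h (by rw [hk, torusEigenvalue_zero]), fun hk => ne_of_gt ?_⟩
  by_cases hl : IsLowestMode k
  · rw [hl.torusEigenvalue_eq hn]; positivity
  · exact lt_of_lt_of_le (by positivity) (two_mul_le_torusEigenvalue hn hk hl)

lemma sum_torusEigenvalue (hd : 1 ≤ d) (hn : 4 ≤ n) :
    ∑ k : Torus d n, torusEigenvalue k = (n : ℝ) ^ d := by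
  have : Fact (1 < n) := ⟨by omega⟩
  have hd' : (d : ℝ) ≠ 0 := Nat.cast_ne_zero.2 (by omega)
  have hcos : ∀ j : Fin d, ∑ k : Torus d n, Real.cos (2 * Real.pi * (k j).val / n) = 0 := by
    intro j
    have hne : (Pi.single j 1 : Torus d n) ≠ 0 := fun h => by simpa using congrFun h j
    have h1 : ∑ k : Torus d n, (torusChar k (Pi.single j 1) + torusChar k (-Pi.single j 1)) =
        0 := by
      rw [Finset.sum_add_distrib, sum_torusChar, sum_torusChar, if_neg hne,
        if_neg (neg_ne_zero.2 hne), add_zero]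
    simp only [torusChar_single_add_neg] at h1
    rw [← Complex.ofReal_sum, ← Finset.mul_sum] at h1
    have h2 := Complex.ofReal_eq_zero.1 h1
    linarith
  have hcos' : ∑ k : Torus d n, ∑ j, Real.cos (2 * Real.pi * (k j).val / n) = 0 := by
    rw [Finset.sum_comm]
    exact Finset.sum_eq_zero fun j _ => hcos j
  simp only [torusEigenvalue, Finset.sum_sub_distrib, ← Finset.mul_sum]
  rw [hcos']
  simp [ZMod.card]
  field_simp

/-- A sum over all modes, estimated separately on the `2 d` lowest modes and on the others. -/
lemma sum_le_of_isLowestMode {f g : Torus d n → ℝ} {a : ℝ} (ha : 0 ≤ a)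
    (hlow : ∀ k, IsLowestMode k → f k ≤ a) (hother : ∀ k, ¬IsLowestMode k → f k ≤ g k)
    (hg : ∀ k, 0 ≤ g k) : ∑ k, f k ≤ 2 * d * a + ∑ k, g k := by
  classical
  set S : Finset (Torus d n) := (Finset.univ : Finset (Fin d)).image (fun j => Pi.single j 1) ∪
    (Finset.univ : Finset (Fin d)).image (fun j => Pi.single j (-1)) with hS
  have hmem : ∀ k, k ∈ S ↔ IsLowestMode k := by
    intro k
    simp only [hS, Finset.mem_union, Finset.mem_image, Finset.mem_univ, true_and, IsLowestMode,
      ← exists_or]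
    exact exists_congr fun j => or_congr eq_comm eq_comm
  have hcard : (S.card : ℝ) ≤ 2 * d := by
    have h1 : S.card ≤ d + d :=
      (Finset.card_union_le _ _).trans (add_le_add
        (Finset.card_image_le.trans (by simp)) (Finset.card_image_le.trans (by simp)))
    calc (S.card : ℝ) ≤ ((d + d : ℕ) : ℝ) := Nat.cast_le.2 h1
      _ = 2 * d := by push_cast; ring
  calc ∑ k, f k ≤ ∑ k, ((if k ∈ S then a else 0) + g k) := by
        refine Finset.sum_le_sum fun k _ => ?_
        by_cases hk : k ∈ S
        · rw [if_pos hk]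
          linarith [hlow k ((hmem k).1 hk), hg k]
        · rw [if_neg hk, zero_add]
          exact hother k fun h => hk ((hmem k).2 h)
    _ = S.card * a + ∑ k, g k := by
        rw [Finset.sum_add_distrib, Finset.sum_ite_mem]
        simp
    _ ≤ 2 * d * a + ∑ k, g k := by
        have := mul_le_mul_of_nonneg_right hcard ha
        linarith

lemma powerEvolution_expectedPower {Ω : Type*} [MeasurableSpace Ω] {μ : Measure Ω}
    [IsProbabilityMeasure μ] {N : Torus d n → ℝ≥0 → Ω → ℕ} {Y : ℝ≥0 → Ω → Torus d n → ℝ}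
    (hd : 1 ≤ d) (hn : 4 ≤ n)
    (h : IsSmoothingProcess (srwMatrix (torusGraph d n)) (Pi.single 0 1) N Y μ) :
    PowerEvolution (torusEigenvalue (d := d) (n := n)) ((n : ℝ) ^ d)⁻¹ (expectedPower d n) where
  weight_nonneg := by positivity
  lam_nonneg := torusEigenvalue_nonneg
  hasDerivAt := hasDerivAt_expectedPower
  init := expectedPower_zero
  nonneg := fun k t ht => by
    rw [← NNReal.coe_mk t ht, ← h.integral_torusPower hd (by omega)]
    exact integral_nonneg fun ω => sq_nonneg _
  weight_sum := by
    rw [sum_torusEigenvalue hd hn]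
    exact inv_mul_cancel₀ (pow_ne_zero _ (Nat.cast_ne_zero.2 (by omega)))

end Spectrum

/-! ### Upper bounds for the heat kernel -/

section HeatKernel

lemma sum_zmod_val {n : ℕ} [NeZero n] (F : ℕ → ℝ) :
    ∑ a : ZMod n, F a.val = ∑ j ∈ Finset.range n, F j := by
  refine Finset.sum_nbij (fun a => a.val) (fun a _ => Finset.mem_range.2 (ZMod.val_lt a))
    (fun a _ b _ h => ZMod.val_injective n h) (fun j hj => ⟨(j : ZMod n), by simp, ?_⟩)
    fun _ _ => rfl
  exact ZMod.val_natCast_of_lt (Finset.mem_range.1 hj)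

/-- The return probability at time `s` of the continuous-time random walk on `ℤ/nℤ` with jump rate
`1`. -/
noncomputable def cycleHeat (n : ℕ) [NeZero n] (s : ℝ) : ℝ :=
  (n : ℝ)⁻¹ * ∑ a : ZMod n, Real.exp (-(s * (1 - Real.cos (2 * Real.pi * a.val / n))))

lemma cycleHeat_nonneg (n : ℕ) [NeZero n] (s : ℝ) : 0 ≤ cycleHeat n s :=
  mul_nonneg (by positivity) (Finset.sum_nonneg fun _ _ => (Real.exp_pos _).le)

lemma cycleHeat_le_one (n : ℕ) [NeZero n] {s : ℝ} (hs : 0 ≤ s) : cycleHeat n s ≤ 1 := by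
  have hn0 : (0 : ℝ) < n := Nat.cast_pos.2 (NeZero.pos n)
  rw [cycleHeat, inv_mul_le_iff₀ hn0]
  calc _ ≤ ∑ a : ZMod n, (1 : ℝ) := Finset.sum_le_sum fun a _ =>
        Real.exp_le_one_iff.2 (neg_nonpos.2 (mul_nonneg hs (sub_nonneg.2 (Real.cos_le_one _))))
    _ = n * 1 := by simp [ZMod.card]

lemma sum_inv_one_add_sq_le {b : ℝ} (hb : 0 < b) (n : ℕ) :
    ∑ j ∈ Finset.range n, (1 + (b * (j + 1 : ℕ)) ^ 2)⁻¹ ≤ 2 / b := by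
  have h : ∀ j : ℕ, (1 + (b * (j + 1 : ℕ)) ^ 2)⁻¹ ≤
      2 / b * ((1 + b * j)⁻¹ - (1 + b * (j + 1 : ℕ))⁻¹) := by
    intro j
    have h1 : (0 : ℝ) < 1 + b * j := by positivity
    have h2 : (0 : ℝ) < 1 + b * (j + 1 : ℕ) := by positivity
    have h3 : 2 / b * ((1 + b * j)⁻¹ - (1 + b * (j + 1 : ℕ))⁻¹) =
        2 / ((1 + b * j) * (1 + b * (j + 1 : ℕ))) := by
      rw [inv_sub_inv h1.ne' h2.ne']
      push_cast
      field_simp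
      ring
    rw [h3, inv_eq_one_div, div_le_div_iff₀ (by positivity) (by positivity)]
    push_cast
    have h4 : 0 ≤ b * j := by positivity
    nlinarith [sq_nonneg (b * (j + 1) - 1)]
  refine (Finset.sum_le_sum fun j _ => h j).trans ?_
  rw [← Finset.mul_sum, Finset.sum_range_sub' (fun j : ℕ => (1 + b * (j : ℝ))⁻¹)]
  refine mul_le_of_le_one_right (by positivity) ?_
  have : 0 ≤ (1 + b * (n : ℝ))⁻¹ := by positivity
  simp only [Nat.cast_zero, mul_zero, add_zero, inv_one]
  linarith

/-- The Gaussian upper bound for the heat kernel on the cycle at the diagonal. -/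
lemma cycleHeat_le_of_pos (n : ℕ) [NeZero n] {s : ℝ} (hs : 0 < s) :
    cycleHeat n s ≤ (n : ℝ)⁻¹ + 2 / √s := by
  have hn0 : (0 : ℝ) < n := Nat.cast_pos.2 (NeZero.pos n)
  set b : ℝ := 2 * √s / n with hb
  have hb0 : 0 < b := by positivity
  set g : ℕ → ℝ := fun j => (1 + (b * j) ^ 2)⁻¹ with hg
  have hg0 : ∀ j, 0 ≤ g j := fun j => by positivity
  have key : ∀ x : ℝ, 0 ≤ x → 2 * x ≤ n →
      Real.exp (-(s * (1 - Real.cos (2 * Real.pi * x / n)))) ≤ (1 + (b * x) ^ 2)⁻¹ := by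
    intro x hx hxn
    have h1 := one_sub_cos_two_pi_mul_ge (a := x / n) (by positivity)
      (by rw [div_le_div_iff₀ hn0 (by norm_num)]; linarith)
    rw [← mul_div_assoc] at h1
    have h2 : (b * x) ^ 2 ≤ s * (1 - Real.cos (2 * Real.pi * x / n)) := by
      have h3 : (b * x) ^ 2 = s * (4 * (x / n) ^ 2) := by
        rw [hb, div_mul_eq_mul_div, div_pow, mul_pow, mul_pow, Real.sq_sqrt hs.le]
        ring
      rw [h3]
      refine mul_le_mul_of_nonneg_left (le_trans ?_ h1) hs.le
      nlinarith [sq_nonneg (x / n)]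
    rw [Real.exp_neg]
    refine inv_anti₀ (by positivity) ?_
    have h4 := Real.add_one_le_exp (s * (1 - Real.cos (2 * Real.pi * x / n)))
    linarith
  -- a frequency is compared with its distance to `0` modulo `n`, on either side
  have hterm : ∀ j ∈ Finset.range n,
      Real.exp (-(s * (1 - Real.cos (2 * Real.pi * j / n)))) ≤ g j + g (n - 1 - j + 1) := by
    intro j hj
    have hjn := Finset.mem_range.1 hj
    have hjn' : (j : ℝ) ≤ n := Nat.cast_le.2 hjn.le
    rcases le_total (2 * (j : ℝ)) n with h | h
    · exact (key j (Nat.cast_nonneg j) h).trans (le_add_of_nonneg_right (hg0 _))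
    · refine le_trans ?_ (le_add_of_nonneg_left (hg0 _))
      have h1 : ((n - 1 - j + 1 : ℕ) : ℝ) = n - j := by
        rw [show n - 1 - j + 1 = n - j by omega, Nat.cast_sub hjn.le]
      simp only [hg, h1]
      rw [← cos_two_pi_sub_div hn0.ne']
      exact key (n - j) (by linarith) (by linarith)
  have hsum : ∑ a : ZMod n, Real.exp (-(s * (1 - Real.cos (2 * Real.pi * a.val / n)))) ≤
      1 + 4 / b := by
    rw [sum_zmod_val fun j => Real.exp (-(s * (1 - Real.cos (2 * Real.pi * j / n))))]
    refine (Finset.sum_le_sum hterm).trans ?_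
    rw [Finset.sum_add_distrib, Finset.sum_range_reflect (fun j => g (j + 1))]
    have h1 : ∑ j ∈ Finset.range n, g (j + 1) ≤ 2 / b := sum_inv_one_add_sq_le hb0 n
    have h2 : ∑ j ∈ Finset.range n, g j ≤ ∑ j ∈ Finset.range n, g (j + 1) + 1 := by
      have h3 := Finset.sum_range_succ' g n
      have h4 := Finset.sum_range_succ g n
      have h5 : g 0 = 1 := by simp [hg]
      have := hg0 n
      linarith
    have h6 : 4 / b = 2 / b + 2 / b := by ring
    linarith
  have h4b : (n : ℝ)⁻¹ * (1 + 4 / b) = (n : ℝ)⁻¹ + 2 / √s := by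
    rw [hb]; field_simp; ring
  rw [cycleHeat, ← h4b]
  exact mul_le_mul_of_nonneg_left hsum (by positivity)

lemma cycleHeat_le (n : ℕ) [NeZero n] {s : ℝ} (hs : 0 ≤ s) :
    cycleHeat n s ≤ (n : ℝ)⁻¹ + 3 / √(1 + s) := by
  have hn0 : (0 : ℝ) < n := Nat.cast_pos.2 (NeZero.pos n)
  have h1 : 0 < √(1 + s) := Real.sqrt_pos.2 (by linarith)
  have h1' : √(1 + s) ^ 2 = 1 + s := Real.sq_sqrt (by linarith)
  rcases le_total s 1 with h | h
  · refine (cycleHeat_le_one n hs).trans ?_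
    have : 1 ≤ 3 / √(1 + s) := by
      rw [le_div_iff₀ h1]; nlinarith
    have : 0 ≤ (n : ℝ)⁻¹ := by positivity
    linarith
  · refine (cycleHeat_le_of_pos n (by linarith)).trans (add_le_add le_rfl ?_)
    have h2 : 0 < √s := Real.sqrt_pos.2 (by linarith)
    have h2' : √s ^ 2 = s := Real.sq_sqrt hs
    rw [div_le_div_iff₀ h2 h1]
    refine abs_le_of_sq_le_sq' ?_ (by positivity) |>.2
    nlinarith

variable {d n : ℕ} [NeZero n]

/-- The heat kernel on the torus is a product of heat kernels on the cycle. -/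
lemma sum_exp_torusEigenvalue (t : ℝ) :
    ((n : ℝ) ^ d)⁻¹ * ∑ k : Torus d n, Real.exp (-(t * torusEigenvalue k)) =
      cycleHeat n (t / d) ^ d := by
  rw [cycleHeat, mul_pow, Fintype.sum_pow, inv_pow]
  congr 1
  refine Finset.sum_congr rfl fun k _ => ?_
  rw [← Real.exp_sum, torusEigenvalue, Finset.sum_neg_distrib, ← Finset.mul_sum]
  congr 2
  ring

lemma sum_exp_torusEigenvalue_le (hd : 1 ≤ d) {t : ℝ} (ht : 0 ≤ t) :
    ((n : ℝ) ^ d)⁻¹ * ∑ k : Torus d n, Real.exp (-(t / 2 * torusEigenvalue k)) ≤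
      (6 * d * ((n : ℝ)⁻¹ + (1 + t) ^ (-(1 / 2) : ℝ))) ^ d := by
  have hd' : (1 : ℝ) ≤ d := by exact_mod_cast hd
  have hn0 : (0 : ℝ) < n := Nat.cast_pos.2 (NeZero.pos n)
  rw [sum_exp_torusEigenvalue]
  refine pow_le_pow_left₀ (cycleHeat_nonneg n _) ((cycleHeat_le n (by positivity)).trans ?_) d
  have h1 : (1 + t) ^ (-(1 / 2) : ℝ) = (√(1 + t))⁻¹ := by
    rw [Real.rpow_neg (by linarith), Real.sqrt_eq_rpow]
  have h2 : 0 < √(1 + t) := Real.sqrt_pos.2 (by linarith)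
  have h2' : √(1 + t) ^ 2 = 1 + t := Real.sq_sqrt (by linarith)
  have h3 : 0 < √(1 + t / 2 / d) := Real.sqrt_pos.2 (by positivity)
  have h3' : √(1 + t / 2 / d) ^ 2 = 1 + t / 2 / d := Real.sq_sqrt (by positivity)
  have h4 : √(1 + t) ≤ 2 * d * √(1 + t / 2 / d) := by
    refine abs_le_of_sq_le_sq' ?_ (by positivity) |>.2
    rw [mul_pow, h2', h3']
    have : (2 * d : ℝ) ^ 2 * (1 + t / 2 / d) = 4 * d ^ 2 + 2 * d * t := by
      field_simp
      ring
    rw [this]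
    nlinarith
  rw [h1, mul_add]
  refine add_le_add (le_mul_of_one_le_left (by positivity) (by linarith)) ?_
  rw [← div_eq_mul_inv, div_le_div_iff₀ h3 h2]
  nlinarith

/-- The constant in the upper bound for the renewal kernel on the torus. -/
noncomputable def kernelConst (d : ℕ) : ℝ := 800 * d + 36 * (12 * d) ^ d

/-- The renewal kernel decays like `(1 + t)^(-(d / 2 + 2))` until the mixing time of order `n²`, and
exponentially at twice the spectral gap from then on. The lowest modes are treated separately,
because they show no decay after tilting. -/
lemma renewalKernel_torus_le (hd : 1 ≤ d) (hn : 4 ≤ n) {r : ℝ} (hr : r ≤ 2 * cycleGap n / d)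
    {t : ℝ} (ht : 0 ≤ t) :
    renewalKernel (torusEigenvalue (d := d) (n := n)) ((n : ℝ) ^ d)⁻¹ t * Real.exp (r * t) ≤
      kernelConst d * decayProfile ((d : ℝ) / 2 + 1 + 1) ((n : ℝ) ^ (d + 4))⁻¹ t := by
  have hd' : (1 : ℝ) ≤ d := by exact_mod_cast hd
  have hn0 : (0 : ℝ) < n := Nat.cast_pos.2 (by omega)
  have hγ0 : 0 ≤ cycleGap n := sub_nonneg.2 (Real.cos_le_one _)
  have hγ := cycleGap_le n
  have ht1 : 0 < 1 + t := by linarith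
  set x : ℝ := (1 + t) ^ (-(1 / 2) : ℝ) with hx
  have hx0 : 0 < x := Real.rpow_pos_of_pos ht1 _
  have hx2 : x ^ 2 = (1 + t)⁻¹ := by
    rw [hx, ← Real.rpow_natCast, ← Real.rpow_mul ht1.le, ← Real.rpow_neg_one]
    norm_num
  have hxd : x ^ (d + 4) = (1 + t) ^ (-((d : ℝ) / 2 + 1 + 1)) := by
    rw [hx, ← Real.rpow_natCast, ← Real.rpow_mul ht1.le]
    congr 1
    push_cast
    ring
  -- the modes other than the lowest ones
  have hother : ∀ k : Torus d n, ¬IsLowestMode k →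
      torusEigenvalue k ^ 2 * Real.exp (-2 * torusEigenvalue k * t) * Real.exp (r * t) ≤
        36 * x ^ 4 * Real.exp (-(t / 2 * torusEigenvalue k)) := by
    intro k hk
    by_cases hk0 : k = 0
    · rw [hk0, torusEigenvalue_zero]
      have : 0 ≤ 36 * x ^ 4 * Real.exp (-(t / 2 * 0)) := by positivity
      simpa using this
    set l := torusEigenvalue k with hl
    have hl0 : 0 ≤ l := torusEigenvalue_nonneg k
    have hl2 : l ≤ 2 := torusEigenvalue_le_two k
    have hrl : r ≤ l := hr.trans (two_mul_le_torusEigenvalue hn hk0 hk)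
    have h1 : Real.exp (-2 * l * t) * Real.exp (r * t) ≤
        Real.exp (-(t * l / 4)) ^ 2 * Real.exp (-(t / 2 * l)) := by
      rw [← Real.exp_nat_mul, ← Real.exp_add, ← Real.exp_add, Real.exp_le_exp]
      push_cast
      nlinarith
    have h2 : (1 + t) * (l * Real.exp (-(t * l / 4))) ≤ 6 := by
      have h3 : Real.exp (-(t * l / 4)) ≤ 1 := Real.exp_le_one_iff.2 (by
        have : 0 ≤ t * l / 4 := by positivity
        linarith)
      have h4 : t * l / 4 * Real.exp (-(t * l / 4)) ≤ 1 := by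
        rw [Real.exp_neg, ← div_eq_mul_inv, div_le_one (Real.exp_pos _)]
        linarith [Real.add_one_le_exp (t * l / 4)]
      have h5 := Real.exp_pos (-(t * l / 4))
      nlinarith
    have h6 : l * Real.exp (-(t * l / 4)) ≤ 6 * x ^ 2 := by
      rw [hx2, ← div_eq_mul_inv, le_div_iff₀ ht1, mul_comm]
      exact h2
    have h7 : (l * Real.exp (-(t * l / 4))) ^ 2 ≤ (6 * x ^ 2) ^ 2 :=
      pow_le_pow_left₀ (by positivity) h6 2
    calc l ^ 2 * Real.exp (-2 * l * t) * Real.exp (r * t)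
        ≤ l ^ 2 * (Real.exp (-(t * l / 4)) ^ 2 * Real.exp (-(t / 2 * l))) := by
          rw [mul_assoc]; exact mul_le_mul_of_nonneg_left h1 (sq_nonneg _)
      _ = (l * Real.exp (-(t * l / 4))) ^ 2 * Real.exp (-(t / 2 * l)) := by ring
      _ ≤ (6 * x ^ 2) ^ 2 * Real.exp (-(t / 2 * l)) :=
          mul_le_mul_of_nonneg_right h7 (Real.exp_pos _).le
      _ = _ := by ring
  have hlow : ∀ k : Torus d n, IsLowestMode k →
      torusEigenvalue k ^ 2 * Real.exp (-2 * torusEigenvalue k * t) * Real.exp (r * t) ≤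
        400 / (n : ℝ) ^ 4 := by
    intro k hk
    rw [hk.torusEigenvalue_eq hn, mul_assoc, ← Real.exp_add]
    have h1 : Real.exp (-2 * (cycleGap n / d) * t + r * t) ≤ 1 := by
      rw [Real.exp_le_one_iff]
      have : -2 * (cycleGap n / d) * t + r * t = -((2 * cycleGap n / d - r) * t) := by ring
      rw [this]
      exact neg_nonpos.2 (mul_nonneg (sub_nonneg.2 hr) ht)
    have h2 : (cycleGap n / d) ^ 2 ≤ 400 / (n : ℝ) ^ 4 := by
      have h3 : cycleGap n / d ≤ 20 / (n : ℝ) ^ 2 := (div_le_self hγ0 hd').trans hγ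
      calc (cycleGap n / d) ^ 2 ≤ (20 / (n : ℝ) ^ 2) ^ 2 := pow_le_pow_left₀ (by positivity) h3 2
        _ = _ := by ring
    calc _ ≤ (cycleGap n / d) ^ 2 * 1 := mul_le_mul_of_nonneg_left h1 (sq_nonneg _)
      _ ≤ _ := by rw [mul_one]; exact h2
  have hsum := sum_le_of_isLowestMode (a := 400 / (n : ℝ) ^ 4) (by positivity) hlow hother
    fun k => by positivity
  have hheat := sum_exp_torusEigenvalue_le (n := n) hd ht
  rw [← hx] at hheat
  -- `x ^ 4 * (n⁻¹ + x) ^ d` is controlled by the larger of `n⁻¹` and `x`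
  have hmax : x ^ 4 * ((n : ℝ)⁻¹ + x) ^ d ≤
      2 ^ d * decayProfile ((d : ℝ) / 2 + 1 + 1) ((n : ℝ) ^ (d + 4))⁻¹ t := by
    have hni : 0 < (n : ℝ)⁻¹ := inv_pos.2 hn0
    rw [decayProfile, ← hxd, ← inv_pow]
    rcases le_total x (n : ℝ)⁻¹ with h | h
    · calc x ^ 4 * ((n : ℝ)⁻¹ + x) ^ d ≤ (n : ℝ)⁻¹ ^ 4 * (2 * (n : ℝ)⁻¹) ^ d := by
            gcongr; linarith
        _ = 2 ^ d * (n : ℝ)⁻¹ ^ (d + 4) := by ring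
        _ ≤ _ := mul_le_mul_of_nonneg_left (le_add_of_nonneg_left (by positivity)) (by positivity)
    · calc x ^ 4 * ((n : ℝ)⁻¹ + x) ^ d ≤ x ^ 4 * (2 * x) ^ d := by
            gcongr; linarith
        _ = 2 ^ d * x ^ (d + 4) := by ring
        _ ≤ _ := mul_le_mul_of_nonneg_left (le_add_of_nonneg_right (by positivity)) (by positivity)
  have hlowsum : ((n : ℝ) ^ d)⁻¹ * (2 * d * (400 / (n : ℝ) ^ 4)) ≤
      800 * d * decayProfile ((d : ℝ) / 2 + 1 + 1) ((n : ℝ) ^ (d + 4))⁻¹ t := by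
    have h1 : ((n : ℝ) ^ d)⁻¹ * (2 * d * (400 / (n : ℝ) ^ 4)) =
        800 * d * ((n : ℝ) ^ (d + 4))⁻¹ := by
      rw [pow_add]; field_simp; norm_num
    rw [h1]
    refine mul_le_mul_of_nonneg_left ?_ (by positivity)
    exact le_add_of_nonneg_left (Real.rpow_nonneg ht1.le _)
  have hothersum : ((n : ℝ) ^ d)⁻¹ *
      ∑ k : Torus d n, 36 * x ^ 4 * Real.exp (-(t / 2 * torusEigenvalue k)) ≤
      36 * (12 * d) ^ d * decayProfile ((d : ℝ) / 2 + 1 + 1) ((n : ℝ) ^ (d + 4))⁻¹ t := by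
    rw [← Finset.mul_sum, mul_left_comm]
    calc _ ≤ 36 * x ^ 4 * (6 * d * ((n : ℝ)⁻¹ + x)) ^ d :=
          mul_le_mul_of_nonneg_left hheat (by positivity)
      _ = 36 * (6 * d) ^ d * (x ^ 4 * ((n : ℝ)⁻¹ + x) ^ d) := by rw [mul_pow]; ring
      _ ≤ 36 * (6 * d) ^ d * (2 ^ d *
          decayProfile ((d : ℝ) / 2 + 1 + 1) ((n : ℝ) ^ (d + 4))⁻¹ t) :=
          mul_le_mul_of_nonneg_left hmax (by positivity)
      _ = _ := by rw [show (12 * d : ℝ) = 6 * d * 2 by ring, mul_pow (6 * d : ℝ)]; ring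
  have hfinal := mul_le_mul_of_nonneg_left hsum (show 0 ≤ ((n : ℝ) ^ d)⁻¹ by positivity)
  rw [mul_add] at hfinal
  rw [renewalKernel, mul_assoc, Finset.sum_mul, kernelConst, add_mul]
  linarith

end HeatKernel

/-! ### Lower bounds for spectral sums -/

section Bounds

variable {d n : ℕ} [NeZero n]

/-- At a time `t` before the mixing time of order `n²` there are of order `n^d t^(-d/2)` modes
with eigenvalues comparable to `1 / t`. -/
lemma exists_modes_eigenvalue (hd : 1 ≤ d) {t : ℝ} (ht : 4 ≤ t) (htn : t ≤ (n : ℝ) ^ 2) :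
    ∃ S : Finset (Torus d n), (n / (4 * √t)) ^ d ≤ (S.card : ℝ) ∧
      ∀ k ∈ S, 1 / (2 * t) ≤ torusEigenvalue k ∧ torusEigenvalue k ≤ 20 / t := by
  have hd' : (1 : ℝ) ≤ d := by exact_mod_cast hd
  have hn0 : (0 : ℝ) < n := Nat.cast_pos.2 (NeZero.pos n)
  have ht0 : 0 < t := by linarith
  have hs0 : 0 < √t := Real.sqrt_pos.2 ht0
  have hs2 : √t ^ 2 = t := Real.sq_sqrt ht0.le
  have hs : 2 ≤ √t := Real.le_sqrt_of_sq_le (by norm_num; exact ht)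
  have hsn : √t ≤ n := Real.sqrt_le_iff.2 ⟨hn0.le, htn⟩
  -- the modes with all coordinates in `(m / 2, m]`, where `m` is the integer part of `n / √t`
  set y : ℝ := n / √t with hy
  have hy1 : 1 ≤ y := (one_le_div hs0).2 hsn
  have hyn : 2 * y ≤ n := by
    rw [hy, ← mul_div_assoc, div_le_iff₀ hs0]; nlinarith
  set m : ℕ := ⌊y⌋₊ with hm
  have hmy : (m : ℝ) ≤ y := Nat.floor_le (by linarith)
  have hym : y < m + 1 := Nat.lt_floor_add_one y
  have hm1 : 1 ≤ m := (Nat.one_le_floor_iff y).2 hy1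
  have hm1' : (1 : ℝ) ≤ m := by exact_mod_cast hm1
  have hmn : 2 * m ≤ n := by
    have : (2 * m : ℝ) ≤ n := by linarith
    exact_mod_cast this
  have hyt : y ^ 2 / n ^ 2 = 1 / t := by
    rw [hy, div_pow, hs2]; field_simp
  set S₁ : Finset (ZMod n) := (Finset.Ioc (m / 2) m).image (fun i : ℕ => (i : ZMod n)) with hS₁
  have hval : ∀ i ∈ Finset.Ioc (m / 2) m, (i : ZMod n).val = i := fun i hi => by
    rw [Finset.mem_Ioc] at hi
    exact ZMod.val_natCast_of_lt (by omega)
  have hcard : S₁.card = m - m / 2 := by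
    rw [hS₁, Finset.card_image_of_injOn, Nat.card_Ioc]
    intro i hi j hj hij
    rw [← hval i hi, ← hval j hj]
    exact congrArg ZMod.val hij
  have hcard' : y / 4 ≤ S₁.card := by
    have h1 : m ≤ 2 * S₁.card := by omega
    have h2 : (m : ℝ) ≤ 2 * S₁.card := by exact_mod_cast h1
    linarith
  refine ⟨Fintype.piFinset fun _ => S₁, ?_, fun k hk => ?_⟩
  · rw [Fintype.card_piFinset_const]
    push_cast
    refine pow_le_pow_left₀ (by positivity) (le_trans (le_of_eq ?_) hcard') d
    rw [hy]; field_simp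
  · have hcoord : ∀ j, 1 / (2 * t) ≤ 1 - Real.cos (2 * Real.pi * (k j).val / n) ∧
        1 - Real.cos (2 * Real.pi * (k j).val / n) ≤ 20 / t := by
      intro j
      obtain ⟨i, hi, hik⟩ := Finset.mem_image.1 (Fintype.mem_piFinset.1 hk j)
      rw [← hik, hval i hi, mul_div_assoc]
      rw [Finset.mem_Ioc] at hi
      have hi1 : (m : ℝ) + 1 ≤ 2 * i := by
        have : m + 1 ≤ 2 * i := by omega
        exact_mod_cast this
      have hi2 : (i : ℝ) ≤ m := Nat.cast_le.2 hi.2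
      constructor
      · refine le_trans ?_ (one_sub_cos_two_pi_mul_ge (a := i / n) (by positivity) ?_)
        · calc 1 / (2 * t) = 1 / t / 2 := by field_simp
            _ = 2 * (y ^ 2 / 4) / n ^ 2 := by rw [← hyt]; ring
            _ ≤ 8 * (i : ℝ) ^ 2 / n ^ 2 := by
                refine div_le_div_of_nonneg_right ?_ (by positivity)
                nlinarith
            _ = _ := by ring
        · rw [div_le_div_iff₀ hn0 (by norm_num)]
          linarith
      · refine (one_sub_cos_two_pi_mul_le _).trans ?_
        calc 20 * ((i : ℝ) / n) ^ 2 = 20 * (i : ℝ) ^ 2 / n ^ 2 := by ring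
          _ ≤ 20 * y ^ 2 / n ^ 2 := by
              refine div_le_div_of_nonneg_right ?_ (by positivity)
              have : (i : ℝ) ≤ y := hi2.trans hmy
              gcongr
          _ = 20 * (1 / t) := by rw [← hyt]; ring
          _ = _ := by ring
    have hd0 : (0 : ℝ) < d := by linarith
    rw [torusEigenvalue]
    constructor
    · rw [← div_eq_inv_mul, le_div_iff₀ hd0]
      calc 1 / (2 * t) * d = ∑ j : Fin d, 1 / (2 * t) := by simp [mul_comm]
        _ ≤ _ := Finset.sum_le_sum fun j _ => (hcoord j).1
    · rw [← div_eq_inv_mul, div_le_iff₀ hd0]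
      calc _ ≤ ∑ j : Fin d, 20 / t := Finset.sum_le_sum fun j _ => (hcoord j).2
        _ = 20 / t * d := by simp [mul_comm]

/-- The constant in the lower bounds. -/
noncomputable def lowerConst (d : ℕ) : ℝ := (1 / 4) ^ d * Real.exp (-40) / (2 * d)

lemma lowerConst_pos (hd : 1 ≤ d) : 0 < lowerConst d := by
  have : (0 : ℝ) < d := by exact_mod_cast hd
  unfold lowerConst
  positivity

lemma lowerConst_le (hd : 1 ≤ d) :
    lowerConst d ≤ (1 / 4) ^ d * Real.exp (-40) / 2 ∧ lowerConst d ≤ 1 / d := by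
  have hd' : (1 : ℝ) ≤ d := by exact_mod_cast hd
  have h0 : 0 < (1 / 4 : ℝ) ^ d * Real.exp (-40) := by positivity
  have h1 : (1 / 4 : ℝ) ^ d * Real.exp (-40) ≤ 1 :=
    mul_le_one₀ (pow_le_one₀ (by norm_num) (by norm_num)) (Real.exp_pos _).le
      (Real.exp_le_one_iff.2 (by norm_num))
  unfold lowerConst
  constructor
  · exact div_le_div_of_nonneg_left h0.le (by norm_num) (by linarith)
  · rw [div_le_div_iff₀ (by linarith) (by linarith)]
    nlinarith

/-- Before the mixing time, a power law in `t` is a lower bound for a spectral sum. -/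
lemma lower_bound_of_le_sq (hd : 1 ≤ d) {t : ℝ} (ht : 4 ≤ t) (htn : t ≤ (n : ℝ) ^ 2)
    {F : Torus d n → ℝ} {b : ℝ} (hb : 0 ≤ b) (hF : ∀ k, 0 ≤ F k)
    (hFb : ∀ k, 1 / (2 * t) ≤ torusEigenvalue k → torusEigenvalue k ≤ 20 / t →
      b * Real.exp (-2 * torusEigenvalue k * t) ≤ F k) :
    (1 / 4) ^ d * Real.exp (-40) * (b * t ^ (-((d : ℝ) / 2))) ≤ ((n : ℝ) ^ d)⁻¹ * ∑ k, F k := by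
  have hn0 : (0 : ℝ) < n := Nat.cast_pos.2 (NeZero.pos n)
  have ht0 : 0 < t := by linarith
  obtain ⟨S, hcard, hS⟩ := exists_modes_eigenvalue hd ht htn
  have h1 : ∀ k ∈ S, b * Real.exp (-40) ≤ F k := by
    intro k hk
    obtain ⟨h2, h3⟩ := hS k hk
    refine le_trans (mul_le_mul_of_nonneg_left (Real.exp_le_exp.2 ?_) hb) (hFb k h2 h3)
    rw [le_div_iff₀ ht0] at h3
    linarith
  have h4 : (n / (4 * √t)) ^ d * (b * Real.exp (-40)) ≤ ∑ k, F k := by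
    calc _ ≤ S.card * (b * Real.exp (-40)) :=
          mul_le_mul_of_nonneg_right hcard (mul_nonneg hb (Real.exp_pos _).le)
      _ ≤ ∑ k ∈ S, F k := by
          rw [← nsmul_eq_mul]; exact Finset.card_nsmul_le_sum S F _ h1
      _ ≤ _ := Finset.sum_le_sum_of_subset_of_nonneg (Finset.subset_univ S) fun k _ _ => hF k
  have h5 : t ^ (-((d : ℝ) / 2)) = ((√t) ^ d)⁻¹ := by
    rw [Real.rpow_neg ht0.le, Real.sqrt_eq_rpow, ← Real.rpow_natCast, ← Real.rpow_mul ht0.le]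
    congr 2
    ring
  refine le_trans (le_of_eq ?_) (mul_le_mul_of_nonneg_left h4 (by positivity))
  rw [h5, div_pow, div_pow, mul_pow, one_pow]
  field_simp

/-- A mode at which the eigenvalue is the spectral gap gives a lower bound at all times. -/
lemma lower_bound_single (hd : 1 ≤ d) (hn : 4 ≤ n) {t : ℝ} {F : Torus d n → ℝ} {b : ℝ}
    (hF : ∀ k, 0 ≤ F k)
    (hFb : ∀ k, torusEigenvalue k = cycleGap n / d →
      b * Real.exp (-2 * torusEigenvalue k * t) ≤ F k) :
    ((n : ℝ) ^ d)⁻¹ * (b * Real.exp (-(2 * cycleGap n / d) * t)) ≤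
      ((n : ℝ) ^ d)⁻¹ * ∑ k, F k := by
  have hlow : IsLowestMode (Pi.single (⟨0, hd⟩ : Fin d) 1 : Torus d n) := ⟨_, Or.inl rfl⟩
  refine mul_le_mul_of_nonneg_left ?_ (by positivity)
  refine le_trans (le_trans (le_of_eq ?_) (hFb _ (hlow.torusEigenvalue_eq hn)))
    (Finset.single_le_sum (fun k _ => hF k) (Finset.mem_univ _))
  rw [hlow.torusEigenvalue_eq hn]
  congr 2
  ring

lemma rpow_le_pow_iff_le_sq {t x : ℝ} (ht : 0 < t) (hx : 0 < x) {p : ℝ} (hp : 0 < p) {q : ℕ}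
    (hpq : 2 * p = q) : t ^ p ≤ x ^ q ↔ t ≤ x ^ 2 := by
  have h : x ^ q = (x ^ 2) ^ p := by
    rw [← Real.rpow_natCast x 2, ← Real.rpow_mul hx.le, ← Real.rpow_natCast, ← hpq]
    norm_num
  rw [h]
  exact Real.rpow_le_rpow_iff ht.le (by positivity) hp

/-- Lower bounds before and after the mixing time combine into one. -/
lemma div_min_le {t x α β E s : ℝ} (ht : 0 < t) (hx : 0 < x) {p : ℝ} (hp : 0 < p) {q : ℕ}
    (hpq : 2 * p = q) (hα : 0 ≤ α) (hβ : 0 ≤ β) (hE : E ≤ 1) (hE0 : 0 ≤ E)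
    (h1 : t ≤ x ^ 2 → α * t ^ (-p) ≤ s) (h2 : β * (x ^ q)⁻¹ * E ≤ s) :
    min α β / min (t ^ p) (x ^ q) * E ≤ s := by
  rcases le_or_gt t (x ^ 2) with h | h
  · rw [min_eq_left ((rpow_le_pow_iff_le_sq ht hx hp hpq).2 h)]
    refine le_trans ?_ (h1 h)
    rw [Real.rpow_neg ht.le, ← div_eq_mul_inv]
    refine (mul_le_of_le_one_right (by positivity) hE).trans ?_
    exact div_le_div_of_nonneg_right (min_le_left _ _) (by positivity)
  · have h3 : x ^ q ≤ t ^ p := by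
      by_contra hcon
      exact absurd ((rpow_le_pow_iff_le_sq ht hx hp hpq).1 (not_le.1 hcon).le) (not_le.2 h)
    rw [min_eq_right h3]
    refine le_trans (mul_le_mul_of_nonneg_right ?_ hE0) h2
    rw [← div_eq_mul_inv]
    exact div_le_div_of_nonneg_right (min_le_right _ _) (by positivity)

lemma decayProfile_le_div_min {t x : ℝ} (ht : 0 < t) (hx : 0 < x) {p : ℝ} (hp : 0 < p) (q : ℕ) :
    decayProfile p (x ^ q)⁻¹ t ≤ 2 / min (t ^ p) (x ^ q) := by
  have htp : 0 < t ^ p := Real.rpow_pos_of_pos ht _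
  have hxq : 0 < x ^ q := by positivity
  have hm : 0 < min (t ^ p) (x ^ q) := lt_min htp hxq
  have h1 : (1 + t) ^ (-p) ≤ (min (t ^ p) (x ^ q))⁻¹ := by
    rw [Real.rpow_neg (by linarith)]
    refine inv_anti₀ hm ((min_le_left _ _).trans ?_)
    exact Real.rpow_le_rpow ht.le (by linarith) hp.le
  have h2 : (x ^ q)⁻¹ ≤ (min (t ^ p) (x ^ q))⁻¹ := inv_anti₀ hm (min_le_right _ _)
  rw [decayProfile, show 2 / min (t ^ p) (x ^ q) =
    (min (t ^ p) (x ^ q))⁻¹ + (min (t ^ p) (x ^ q))⁻¹ by ring]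
  exact add_le_add h1 h2

end Bounds

/-! ### Bounds for the expected energy and variance -/

section Main

variable {d n : ℕ} [NeZero n]

/-- The decay rate in the upper bounds. The constant `6400` is such that the `2 d` lowest modes, at
which `λ² ≤ 400 / n^4`, add at most `2 * 400 / 6400 = 1 / 8` to the mass of the tilted kernel. -/
noncomputable def decayRate (d n : ℕ) : ℝ := 2 * cycleGap n / d - 6400 / (n : ℝ) ^ (d + 4)

lemma decayRate_ge {d n : ℕ} (hd : 1 ≤ d) (hn : 800 * d ≤ n) :
    8 / (d * (n : ℝ) ^ 2) ≤ decayRate d n := by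
  have hd' : (1 : ℝ) ≤ d := by exact_mod_cast hd
  have hn' : (800 * d : ℝ) ≤ n := by exact_mod_cast hn
  have hn1 : (1 : ℝ) ≤ n := by linarith
  have hγ := cycleGap_ge (n := n) (by omega)
  have h1 : 6400 / (n : ℝ) ^ (d + 4) ≤ 8 / (d * (n : ℝ) ^ 2) := by
    rw [div_le_div_iff₀ (by positivity) (by positivity)]
    have h2 : (n : ℝ) ^ 3 ≤ (n : ℝ) ^ (d + 4) := pow_le_pow_right₀ hn1 (by omega)
    have h3 : (800 * d) * (n : ℝ) ^ 2 ≤ n * (n : ℝ) ^ 2 :=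
      mul_le_mul_of_nonneg_right hn' (by positivity)
    have h4 : (n : ℝ) * (n : ℝ) ^ 2 = (n : ℝ) ^ 3 := by ring
    linarith
  have h5 : 16 / (d * (n : ℝ) ^ 2) ≤ 2 * cycleGap n / d := by
    calc 16 / (d * (n : ℝ) ^ 2) = 2 * (8 / (n : ℝ) ^ 2) / d := by field_simp; norm_num
      _ ≤ _ := by gcongr
  have h6 : 16 / (d * (n : ℝ) ^ 2) = 8 / (d * (n : ℝ) ^ 2) + 8 / (d * (n : ℝ) ^ 2) := by ring
  unfold decayRate
  linarith

lemma decayRate_le (d n : ℕ) : decayRate d n ≤ 2 * cycleGap n / d :=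
  sub_le_self _ (by positivity)

lemma decayRate_lt_two_mul (hd : 1 ≤ d) (hn : 800 * d ≤ n) (k : Torus d n)
    (hk : torusEigenvalue k ≠ 0) : decayRate d n < 2 * torusEigenvalue k := by
  have hn4 : 4 ≤ n := by omega
  have hd' : (0 : ℝ) < d := by exact_mod_cast hd
  have hγ : 0 < cycleGap n := lt_of_lt_of_le (by positivity) (cycleGap_ge (by omega))
  by_cases hl : IsLowestMode k
  · rw [hl.torusEigenvalue_eq hn4, decayRate, ← mul_div_assoc]
    exact sub_lt_self _ (by positivity)
  · have h1 := two_mul_le_torusEigenvalue hn4 ((torusEigenvalue_ne_zero_iff hd hn4 k).1 hk) hl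
    have h2 := decayRate_le d n
    have h3 : 0 < 2 * cycleGap n / d := by positivity
    linarith

/-- The tilted kernel has mass at most `3 / 4`. Without tilting the mass is `1 / 2`; the lowest
modes, at which `λ²` is of order `n^(-4)`, add at most `1 / 8` because the rate stays below twice the
spectral gap by `6400 / n^(d + 4)`, and the other modes add at most `1 / 8`. -/
lemma sum_lyapunov_weight_le (hd : 1 ≤ d) (hn : 800 * d ≤ n) :
    ((n : ℝ) ^ d)⁻¹ * ∑ k : Torus d n,
      torusEigenvalue k ^ 2 / (2 * torusEigenvalue k - decayRate d n) ≤ 3 / 4 := by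
  have hn4 : 4 ≤ n := by omega
  have hd' : (1 : ℝ) ≤ d := by exact_mod_cast hd
  have hn' : (800 * d : ℝ) ≤ n := by exact_mod_cast hn
  have hn1 : (800 : ℝ) ≤ n := by linarith
  have hγ0 : 0 < cycleGap n := lt_of_lt_of_le (by positivity) (cycleGap_ge (by omega))
  have hγ := cycleGap_le n
  set ρ : ℝ := 2 * cycleGap n / d with hρ
  have hρ0 : 0 < ρ := by positivity
  have hρ1 : ρ ≤ 1 / 4 := by
    calc ρ ≤ 2 * cycleGap n := div_le_self (by positivity) hd'
      _ ≤ 2 * (20 / (n : ℝ) ^ 2) := by linarith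
      _ ≤ 1 / 4 := by
        rw [← mul_div_assoc, div_le_div_iff₀ (by positivity) (by norm_num)]
        nlinarith
  have hrρ : decayRate d n ≤ ρ := decayRate_le d n
  have hlow : ∀ k : Torus d n, IsLowestMode k →
      torusEigenvalue k ^ 2 / (2 * torusEigenvalue k - decayRate d n) ≤
        (n : ℝ) ^ d / (16 * d) := by
    intro k hk
    rw [hk.torusEigenvalue_eq hn4, decayRate,
      show 2 * (cycleGap n / d) - (2 * cycleGap n / d - 6400 / (n : ℝ) ^ (d + 4)) =
        6400 / (n : ℝ) ^ (d + 4) by ring]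
    have h1 : (cycleGap n / d) ^ 2 ≤ 400 / (n : ℝ) ^ 4 / d := by
      calc (cycleGap n / d) ^ 2 ≤ (20 / (n : ℝ) ^ 2 / d) ^ 2 := by gcongr
        _ = 400 / (n : ℝ) ^ 4 / d / d := by ring
        _ ≤ _ := div_le_self (by positivity) hd'
    calc _ ≤ 400 / (n : ℝ) ^ 4 / d / (6400 / (n : ℝ) ^ (d + 4)) := by gcongr
      _ = (n : ℝ) ^ d / (16 * d) := by rw [pow_add]; field_simp; norm_num
  have hother : ∀ k : Torus d n, ¬IsLowestMode k →
      torusEigenvalue k ^ 2 / (2 * torusEigenvalue k - decayRate d n) ≤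
        torusEigenvalue k / 2 + ρ / 2 := by
    intro k hk
    by_cases hk0 : k = 0
    · rw [hk0, torusEigenvalue_zero]
      simp only [ne_eq, OfNat.ofNat_ne_zero, not_false_eq_true, zero_pow, zero_div]
      linarith
    have h1 : ρ ≤ torusEigenvalue k := two_mul_le_torusEigenvalue hn4 hk0 hk
    rw [div_le_iff₀ (by linarith)]
    nlinarith
  have hsum := sum_le_of_isLowestMode (a := (n : ℝ) ^ d / (16 * d)) (by positivity) hlow hother
    fun k => by linarith [torusEigenvalue_nonneg k]
  rw [inv_mul_le_iff₀ (by positivity)]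
  refine hsum.trans ?_
  rw [Finset.sum_add_distrib, ← Finset.sum_div, sum_torusEigenvalue hd hn4]
  simp only [Finset.sum_const, Finset.card_univ, nsmul_eq_mul, Fintype.card_pi, ZMod.card,
    Finset.prod_const, Fintype.card_fin, Nat.cast_pow]
  have h2 : 2 * d * ((n : ℝ) ^ d / (16 * d)) = (n : ℝ) ^ d / 8 := by field_simp; norm_num
  have h3 : (n : ℝ) ^ d * (ρ / 2) ≤ (n : ℝ) ^ d * (1 / 8) :=
    mul_le_mul_of_nonneg_left (by linarith) (by positivity)
  rw [h2]
  linarith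

/-- The constant in the upper bound for the energy, before a factor `2` from the profile. -/
noncomputable def energyConst (d : ℕ) : ℝ :=
  renewalConst (kernelConst d) ((d : ℝ) / 2 + 1 + 1) * (((d : ℝ) / 2 + 1)⁻¹ + d)

/-- The constant in the upper bound for the variance, before a factor `2` from the profile. -/
noncomputable def varianceConst (d : ℕ) : ℝ := 2 * energyConst d * (((d : ℝ) / 2)⁻¹ + d)

lemma renewalConst_kernelConst_nonneg (d : ℕ) :
    0 ≤ renewalConst (kernelConst d) ((d : ℝ) / 2 + 1 + 1) := by
  have h1 : 0 ≤ kernelConst d := by unfold kernelConst; positivity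
  have h2 : 0 ≤ (1 - (6 / 7 : ℝ) ^ ((d : ℝ) / 2 + 1 + 1)⁻¹) ^ (-((d : ℝ) / 2 + 1 + 1)) :=
    Real.rpow_nonneg (sub_nonneg.2 (Real.rpow_le_one (by norm_num) (by norm_num)
      (by positivity))) _
  unfold renewalConst
  positivity

lemma energyConst_nonneg (d : ℕ) : 0 ≤ energyConst d :=
  mul_nonneg (renewalConst_kernelConst_nonneg d) (by positivity)

lemma varianceConst_nonneg (d : ℕ) : 0 ≤ varianceConst d :=
  mul_nonneg (mul_nonneg zero_le_two (energyConst_nonneg d)) (by positivity)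

lemma inv_pow_le_of_decayRate {d n : ℕ} (hd : 1 ≤ d) (hn : 800 * d ≤ n) (q : ℕ) :
    ((n : ℝ) ^ (q + 2))⁻¹ ≤ d * (decayRate d n * ((n : ℝ) ^ q)⁻¹) := by
  have hd' : (0 : ℝ) < d := by exact_mod_cast hd
  have hn0 : (0 : ℝ) < n := Nat.cast_pos.2 (by omega)
  have h1 := decayRate_ge hd hn
  calc ((n : ℝ) ^ (q + 2))⁻¹ ≤ 8 * ((n : ℝ) ^ (q + 2))⁻¹ := by
        have : 0 ≤ ((n : ℝ) ^ (q + 2))⁻¹ := by positivity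
        linarith
    _ = d * (8 / (d * (n : ℝ) ^ 2) * ((n : ℝ) ^ q)⁻¹) := by rw [pow_add]; field_simp
    _ ≤ _ := by gcongr

lemma expectedEnergy_le (h : PowerEvolution (torusEigenvalue (d := d) (n := n)) ((n : ℝ) ^ d)⁻¹
    (expectedPower d n)) (hd : 1 ≤ d) (hn : 800 * d ≤ n) {t : ℝ} (ht : 0 ≤ t) :
    ((n : ℝ) ^ d)⁻¹ * ∑ k, torusEigenvalue k * expectedPower d n k t ≤
      energyConst d * decayProfile ((d : ℝ) / 2 + 1) ((n : ℝ) ^ (d + 2))⁻¹ t *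
        Real.exp (-(decayRate d n * t)) := by
  have hd' : (0 : ℝ) < d := by exact_mod_cast hd
  have hn0 : (0 : ℝ) < n := Nat.cast_pos.2 (by omega)
  have hr : 0 < decayRate d n := lt_of_lt_of_le (by positivity) (decayRate_ge hd hn)
  exact h.energy_le hr (decayRate_lt_two_mul hd hn) (sum_lyapunov_weight_le hd hn)
    (by positivity) (by positivity) (by positivity) hd'.le
    (inv_pow_le_of_decayRate hd hn (d + 2)) (renewalConst_kernelConst_nonneg d)
    (fun s hs => renewalKernel_torus_le hd (by omega) (decayRate_le d n) hs) ht

lemma expectedVariance_le (h : PowerEvolution (torusEigenvalue (d := d) (n := n)) ((n : ℝ) ^ d)⁻¹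
    (expectedPower d n)) (hd : 1 ≤ d) (hn : 800 * d ≤ n) {t : ℝ} (ht : 0 ≤ t) :
    ((n : ℝ) ^ d)⁻¹ * ∑ k with k ≠ 0, expectedPower d n k t ≤
      varianceConst d * decayProfile ((d : ℝ) / 2) ((n : ℝ) ^ d)⁻¹ t *
        Real.exp (-(decayRate d n * t)) := by
  have hd' : (0 : ℝ) < d := by exact_mod_cast hd
  have hn0 : (0 : ℝ) < n := Nat.cast_pos.2 (by omega)
  have hr : 0 < decayRate d n := lt_of_lt_of_le (by positivity) (decayRate_ge hd hn)
  exact h.variance_le hr (decayRate_lt_two_mul hd hn) (sum_lyapunov_weight_le hd hn) _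
    (fun k => by simp [torusEigenvalue_ne_zero_iff hd (show 4 ≤ n by omega) k])
    (by positivity) (by positivity) hd'.le (inv_pow_le_of_decayRate hd hn d)
    (energyConst_nonneg d) (fun s hs => expectedEnergy_le h hd hn hs) ht

lemma le_expectedEnergy (h : PowerEvolution (torusEigenvalue (d := d) (n := n)) ((n : ℝ) ^ d)⁻¹
    (expectedPower d n)) (hd : 1 ≤ d) (hn : 4 ≤ n) {t : ℝ} (ht : 4 ≤ t) :
    lowerConst d / min (t ^ ((d : ℝ) / 2 + 1)) ((n : ℝ) ^ (d + 2)) *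
        Real.exp (-(2 * cycleGap n / d) * t) ≤
      ((n : ℝ) ^ d)⁻¹ * ∑ k, torusEigenvalue k * expectedPower d n k t := by
  have hd' : (0 : ℝ) < d := by exact_mod_cast hd
  have hn0 : (0 : ℝ) < n := Nat.cast_pos.2 (by omega)
  have ht0 : 0 < t := by linarith
  have hγ0 : 0 ≤ cycleGap n := sub_nonneg.2 (Real.cos_le_one _)
  have hF : ∀ k : Torus d n, 0 ≤ torusEigenvalue k * expectedPower d n k t := fun k =>
    mul_nonneg (torusEigenvalue_nonneg k) (h.nonneg k t ht0.le)
  have hmain := div_min_le (α := (1 / 4) ^ d * Real.exp (-40) / 2) (β := 1 / d)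
    (E := Real.exp (-(2 * cycleGap n / d) * t)) ht0 hn0 (p := (d : ℝ) / 2 + 1) (q := d + 2)
    (s := ((n : ℝ) ^ d)⁻¹ * ∑ k, torusEigenvalue k * expectedPower d n k t)
    (by positivity) (by push_cast; ring) (by positivity) (by positivity)
    (Real.exp_le_one_iff.2 (by
      have : 0 ≤ 2 * cycleGap n / d * t := by positivity
      linarith)) (Real.exp_pos _).le
    (fun htn => by
      have h1 := lower_bound_of_le_sq (n := n) hd ht htn (b := 1 / (2 * t)) (by positivity) hF
        fun k hk _ => mul_le_mul hk (h.exp_le_mode k ht0.le) (Real.exp_pos _).le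
          (torusEigenvalue_nonneg k)
      refine le_trans (le_of_eq ?_) h1
      rw [neg_add, Real.rpow_add ht0, Real.rpow_neg_one]
      field_simp)
    (by
      have h1 := lower_bound_single hd hn (t := t) (b := 1 / (d * (n : ℝ) ^ 2)) hF
        fun k hk => mul_le_mul (by
          rw [hk]
          calc 1 / (d * (n : ℝ) ^ 2) ≤ 8 / (n : ℝ) ^ 2 / d := by
                rw [div_div, mul_comm (d : ℝ)]; gcongr; norm_num
            _ ≤ cycleGap n / d := by gcongr; exact cycleGap_ge (by omega))
          (h.exp_le_mode k ht0.le) (Real.exp_pos _).le (torusEigenvalue_nonneg k)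
      refine le_trans (le_of_eq ?_) h1
      rw [pow_add]
      field_simp)
  refine le_trans ?_ hmain
  gcongr
  exact le_min (lowerConst_le hd).1 (lowerConst_le hd).2

lemma le_expectedVariance (h : PowerEvolution (torusEigenvalue (d := d) (n := n)) ((n : ℝ) ^ d)⁻¹
    (expectedPower d n)) (hd : 1 ≤ d) (hn : 4 ≤ n) {t : ℝ} (ht : 4 ≤ t) :
    lowerConst d / min (t ^ ((d : ℝ) / 2)) ((n : ℝ) ^ d) *
        Real.exp (-(2 * cycleGap n / d) * t) ≤
      ((n : ℝ) ^ d)⁻¹ * ∑ k with k ≠ 0, expectedPower d n k t := by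
  have hd' : (1 : ℝ) ≤ d := by exact_mod_cast hd
  have hn0 : (0 : ℝ) < n := Nat.cast_pos.2 (by omega)
  have ht0 : 0 < t := by linarith
  have hγ0 : 0 < cycleGap n := lt_of_lt_of_le (by positivity) (cycleGap_ge (by omega))
  have hF : ∀ k : Torus d n, 0 ≤ if k ≠ 0 then expectedPower d n k t else 0 := fun k => by
    split_ifs
    · exact h.nonneg k t ht0.le
    · exact le_rfl
  have hFb : ∀ k : Torus d n, 0 < torusEigenvalue k →
      1 * Real.exp (-2 * torusEigenvalue k * t) ≤ if k ≠ 0 then expectedPower d n k t else 0 := by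
    intro k hk
    rw [if_pos ((torusEigenvalue_ne_zero_iff hd hn k).1 hk.ne'), one_mul]
    exact h.exp_le_mode k ht0.le
  rw [Finset.sum_filter]
  have hmain := div_min_le (α := (1 / 4) ^ d * Real.exp (-40)) (β := 1)
    (E := Real.exp (-(2 * cycleGap n / d) * t)) ht0 hn0 (p := (d : ℝ) / 2) (q := d)
    (s := ((n : ℝ) ^ d)⁻¹ * ∑ k : Torus d n, if k ≠ 0 then expectedPower d n k t else 0)
    (by positivity) (by ring) (by positivity) (by positivity)
    (Real.exp_le_one_iff.2 (by
      have : 0 ≤ 2 * cycleGap n / d * t := by positivity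
      linarith)) (Real.exp_pos _).le
    (fun htn => by
      have h1 := lower_bound_of_le_sq (n := n) hd ht htn (b := 1) zero_le_one hF
        fun k hk _ => hFb k (lt_of_lt_of_le (by positivity) hk)
      rwa [one_mul] at h1)
    (by
      have h1 := lower_bound_single hd hn (t := t) (b := 1) hF
        fun k hk => hFb k (by rw [hk]; positivity)
      refine le_trans (le_of_eq ?_) h1
      ring)
  refine le_trans ?_ hmain
  gcongr
  refine le_min ((lowerConst_le hd).1.trans ?_) ((lowerConst_le hd).2.trans ?_)
  · exact div_le_self (by positivity) one_le_two
  · exact div_le_one_of_le₀ hd' (by positivity)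

section Expectation

variable {Ω : Type*} [MeasurableSpace Ω] {μ : Measure Ω} [IsProbabilityMeasure μ]
  {N : Torus d n → ℝ≥0 → Ω → ℕ} {Y : ℝ≥0 → Ω → Torus d n → ℝ}

lemma IsSmoothingProcess.integral_torusEnergy (hd : 1 ≤ d) (hn : 3 ≤ n)
    (h : IsSmoothingProcess (srwMatrix (torusGraph d n)) (Pi.single 0 1) N Y μ) (t : ℝ≥0) :
    Integrable (fun ω => torusEnergy d n (Y t ω)) μ ∧
      ∫ ω, torusEnergy d n (Y t ω) ∂μ = ((n : ℝ) ^ d)⁻¹ *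
        (((n : ℝ) ^ d)⁻¹ * ∑ k, torusEigenvalue k * expectedPower d n k t) := by
  have hint : ∀ k, Integrable (fun ω => torusEigenvalue k * torusPower (Y t ω) k) μ := fun k =>
    (h.integrable_torusPower hn t k).const_mul _
  simp only [torusEnergy_eq hd hn]
  refine ⟨((integrable_finsetSum _ fun k _ => hint k).const_mul _).const_mul _, ?_⟩
  rw [integral_const_mul, integral_const_mul, integral_finsetSum _ fun k _ => hint k]
  simp only [integral_const_mul, h.integral_torusPower hd hn]

lemma IsSmoothingProcess.integral_torusVariance (hd : 1 ≤ d) (hn : 3 ≤ n)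
    (h : IsSmoothingProcess (srwMatrix (torusGraph d n)) (Pi.single 0 1) N Y μ) (t : ℝ≥0) :
    Integrable (fun ω => torusVariance d n (Y t ω)) μ ∧
      ∫ ω, torusVariance d n (Y t ω) ∂μ = ((n : ℝ) ^ d)⁻¹ *
        (((n : ℝ) ^ d)⁻¹ * ∑ k with k ≠ 0, expectedPower d n k t) := by
  have hint := h.integrable_torusPower hn t
  simp only [torusVariance_eq]
  refine ⟨((integrable_finsetSum _ fun k _ => hint k).const_mul _).const_mul _, ?_⟩
  rw [integral_const_mul, integral_const_mul, integral_finsetSum _ fun k _ => hint k]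
  simp only [h.integral_torusPower hd hn]

end Expectation

end Main

theorem theorem2p4 (d : ℕ) (hd : 1 ≤ d) :
    ∃ α₁ α₂ α₃ : ℝ, ∃ n₀ : ℕ, ∃ t₀ : ℝ,
      0 < α₁ ∧ 0 < α₂ ∧ 0 < α₃ ∧ 3 ≤ n₀ ∧ 0 < t₀ ∧
      ∀ (n : ℕ) [NeZero n], Odd n → n₀ ≤ n →
      ∀ (Ω : Type*) [MeasurableSpace Ω] (μ : Measure Ω) [IsProbabilityMeasure μ]
        (N : Torus d n → ℝ≥0 → Ω → ℕ) (Y : ℝ≥0 → Ω → Torus d n → ℝ),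
        IsSmoothingProcess (srwMatrix (torusGraph d n)) (Pi.single 0 1) N Y μ →
      ∀ t : ℝ≥0, t₀ ≤ t →
        (Integrable (fun ω => torusEnergy d n (Y t ω)) μ ∧
          α₁ * ((n : ℝ) ^ d)⁻¹ / min ((t : ℝ) ^ ((d : ℝ) / 2 + 1)) ((n : ℝ) ^ (d + 2)) *
              Real.exp (-(2 * cycleGap n / d) * t)
            ≤ ∫ ω, torusEnergy d n (Y t ω) ∂μ ∧
          ∫ ω, torusEnergy d n (Y t ω) ∂μ
            ≤ α₂ * ((n : ℝ) ^ d)⁻¹ / min ((t : ℝ) ^ ((d : ℝ) / 2 + 1)) ((n : ℝ) ^ (d + 2)) *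
              Real.exp (-(2 * cycleGap n / d - α₃ / (n : ℝ) ^ (d + 4)) * t)) ∧
        (Integrable (fun ω => torusVariance d n (Y t ω)) μ ∧
          α₁ * ((n : ℝ) ^ d)⁻¹ / min ((t : ℝ) ^ ((d : ℝ) / 2)) ((n : ℝ) ^ d) *
              Real.exp (-(2 * cycleGap n / d + α₃ / (n : ℝ) ^ (d + 4)) * t)
            ≤ ∫ ω, torusVariance d n (Y t ω) ∂μ ∧
          ∫ ω, torusVariance d n (Y t ω) ∂μ
            ≤ α₂ * ((n : ℝ) ^ d)⁻¹ / min ((t : ℝ) ^ ((d : ℝ) / 2)) ((n : ℝ) ^ d) *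
              Real.exp (-(2 * cycleGap n / d - α₃ / (n : ℝ) ^ (d + 4)) * t)) := by
  have hE0 := energyConst_nonneg d
  have hV0 := varianceConst_nonneg d
  -- `n ≥ 800 d` keeps `decayRate` of order `1 / (d n²)`, and `t ≥ 4` keeps the modes counted in the
  -- lower bounds in the half of the spectrum where `1 - cos` is comparable to a square
  refine ⟨lowerConst d, 2 * (energyConst d + varianceConst d) + 1, 6400, 800 * d, 4,
    lowerConst_pos hd, by positivity, by norm_num, by omega, by norm_num, ?_⟩
  intro n _ _ hn Ω _ μ _ N Y h t ht
  have hn4 : 4 ≤ n := by omega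
  have hn0 : (0 : ℝ) < n := Nat.cast_pos.2 (by omega)
  have hd' : (0 : ℝ) < d := by exact_mod_cast hd
  have ht0 : (0 : ℝ) < t := by linarith
  have hpow := powerEvolution_expectedPower hd hn4 h
  obtain ⟨hEint, hE⟩ := h.integral_torusEnergy hd (by omega) t
  obtain ⟨hVint, hV⟩ := h.integral_torusVariance hd (by omega) t
  have hlc : 0 ≤ lowerConst d := (lowerConst_pos hd).le
  have hmE : 0 < min ((t : ℝ) ^ ((d : ℝ) / 2 + 1)) ((n : ℝ) ^ (d + 2)) :=
    lt_min (Real.rpow_pos_of_pos ht0 _) (by positivity)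
  have hmV : 0 < min ((t : ℝ) ^ ((d : ℝ) / 2)) ((n : ℝ) ^ d) :=
    lt_min (Real.rpow_pos_of_pos ht0 _) (by positivity)
  have hrate : -(2 * cycleGap n / d - 6400 / (n : ℝ) ^ (d + 4)) * t = -(decayRate d n * t) := by
    rw [decayRate]; ring
  have hassoc : ∀ a c m e : ℝ, a * c / m * e = c * (a / m * e) := fun a c m e => by ring
  have hc : 0 ≤ ((n : ℝ) ^ d)⁻¹ := by positivity
  have hupper : ∀ {B D m e s : ℝ}, 0 ≤ B → B ≤ energyConst d + varianceConst d → 0 < m → 0 ≤ e →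
      D ≤ 2 / m → s ≤ B * D * e →
        s ≤ (2 * (energyConst d + varianceConst d) + 1) / m * e := by
    intro B D m e s hB hB' hm he hD hs
    refine hs.trans (mul_le_mul_of_nonneg_right ?_ he)
    calc B * D ≤ B * (2 / m) := mul_le_mul_of_nonneg_left hD hB
      _ = 2 * B / m := by ring
      _ ≤ _ := div_le_div_of_nonneg_right (by linarith) hm.le
  refine ⟨⟨hEint, ?_, ?_⟩, hVint, ?_, ?_⟩
  · rw [hE, hassoc]
    exact mul_le_mul_of_nonneg_left (le_expectedEnergy hpow hd hn4 ht) hc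
  · rw [hE, hassoc, hrate]
    exact mul_le_mul_of_nonneg_left (hupper hE0 (by linarith) hmE (Real.exp_pos _).le
      (decayProfile_le_div_min ht0 hn0 (by positivity) _)
      (expectedEnergy_le hpow hd hn ht0.le)) hc
  · rw [hV, hassoc]
    refine mul_le_mul_of_nonneg_left (le_trans ?_ (le_expectedVariance hpow hd hn4 ht)) hc
    refine mul_le_mul_of_nonneg_left (Real.exp_le_exp.2 ?_) (div_nonneg hlc hmV.le)
    have : 0 ≤ 6400 / (n : ℝ) ^ (d + 4) * t := by positivity
    linarith
  · rw [hV, hassoc, hrate]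
    exact mul_le_mul_of_nonneg_left (hupper hV0 (by linarith) hmV (Real.exp_pos _).le
      (decayProfile_le_div_min ht0 hn0 (by positivity) _)
      (expectedVariance_le hpow hd hn ht0.le)) hc
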